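/- Work on the triangular lattice with one family of lattice lines horizontal. Use coordinates $(i,j)$ whose $i$-axis is a horizontal lattice line, with unit half the side of a unit triangle, and whose $j$-axis is vertical through a lattice vertex (the origin), with unit the height of a unit triangle. A lozenge is a union of two unit triangles sharing an edge; it is vertical if the shared edge is horizontal. A vertical lozenge with center $(i,j)$ has weight $\operatorname{wt}_1(i,j)=\frac{q^i+q^{-i}}{2}$, where $q$ is an indeterminate; all other lozenges have weight $1$. The weight of a lozenge tiling is the product of the weights of its lozenges, and the tiling generating function $\operatorname{M}(R)$ of a region $R$ is the sum of the weights of all its tilings (so $\operatorname{M}(R)=0$ if there is no tiling and $\operatorname{M}(R)=1$ if $R$ has empty interior). Let $x,d,m$ be non-negative integers with $d\ge m$ and let $1\le l_1<l_2<\dots<l_m\le d$ be integers. The region $B_{x,d}(l_1,\dots,l_m)$ is defined as follows. Start with the halved hexagon whose north, northeast, southeast and south sides have lengths $x$, $2d-m+1$, $m$, $x+d-m$ and run through the points $(1,2d+1)$, $(2x+1,2d+1)$, $(2x+2d-m+2,m)$, $(2(x+d-m)+2,0)$, $(2,0)$ in this order, and whose west side is the vertical zigzag $(1,2d+1),(0,2d),(1,2d-1),(0,2d-2),\dots,(1,3),(0,2),(2,0)$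 with $2d$ steps (if $d=0$, the single segment from $(1,1)$ to $(2,0)$); the bottom-most step has length $2$ and all others have length $1$. For $1\le k\le d$ the $k$-th bump (from bottom to top) of the west side is the one with leftmost vertex $(0,2k)$. For every $k\in\{1,\dots,d\}\setminus\{l_1,\dots,l_m\}$ remove the up-pointing unit triangle with vertices $(0,2k),(2,2k),(1,2k+1)$. Write $[n]_p=1+p+\dots+p^{n-1}$, $[n]_p!=[1]_p[2]_p\cdots[n]_p$, $\left\langle\begin{matrix}b\\a\end{matrix}\right\rangle=a+(a+1)+\dots+b$ for $0\le a\le b$, and $f(t,y,z)=\frac{yz(2t+y-z)}{2}$. For sequences $\mathbf l=(l_i)_{i=1}^m$ and $\mathbf h=(h_j)_{j=1}^n$ put $e'=\min(u-n,d-m+1)$, $\tilde x=x+u-n+d-m-e'$, $t_1'=2(x+u-n-e')+1$, $t_2'=2(x+d-m+1-e')$, \begin{align*} E'&=f(t_1'+2d-m,n+1,m)+\sum_{i=1}^{m}\left\langle\begin{matrix}t_1'+2d-m-(m-i+1)\\ t_1'+2(d-l_i)-2(m-i)\end{matrix}\right\rangle+\sum_{i=1}^{n}\left\langle\begin{matrix}t_2'+2u-n-(n-i+1)\\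 t_2'+2(u-h_i)-2(n-i)\end{matrix}\right\rangle,\\ F'&=(n+1)m+\sum_{i=1}^m(2l_i-i)+\sum_{i=1}^n(2h_i-i), \end{align*} and \begin{align*} Q(x,u,d,\mathbf l,\mathbf h)&=2^{-F'}q^{-E'}\,\frac{\prod_{1\le i<j\le m}[2(l_j-l_i)]_{q^2}\prod_{1\le i<j\le n}[2(h_j-h_i)]_{q^2}}{\prod_{i=1}^m\prod_{j=1}^n[2(l_i+h_j)]_{q^2}\prod_{i=1}^m[2l_i]_{q^2}!\prod_{j=1}^n[2h_j-1]_{q^2}!}\\ &\times\prod_{i=1}^{\lceil n/2\rceil}\prod_{j=1}^{2n-4i+3}[2\tilde x+2i+j]_{q^2}\\ &\times\prod_{i=1}^m[2(\tilde x+n+i)]_{q^2}[2(\tilde x+n+i+1)]_{q^2}\prod_{i=1}^m\prod_{j=1}^{n+i-1}[2\tilde x+n+i+j+1]_{q^2}\\ &\times\prod_{i=1}^n\prod_{j=1}^m\frac{[2(\tilde x+i+j-1)]_{q^2}}{[2(\tilde x+i+j-1)+1]_{q^2}}\\ &\times\prod_{i=1}^m\prod_{j=1}^{l_i-i}[2(\tilde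 x+i+j+n+1)]_{q^2}[2(\tilde x-i-j+m+1)]_{q^2}\\ &\times\prod_{i=1}^n\prod_{j=1}^{h_i-i}[2(\tilde x+i+j+m)]_{q^2}[2(\tilde x-i-j+n+2)]_{q^2}. \end{align*} **Theorem (formula for a region of type B).** For all such $x,d,m$ and $(l_i)_{i=1}^m$, as an identity in $\mathbb{Q}(q)$, $$\operatorname{M}(B_{x,d}(l_1,l_2,\dots,l_m))=Q(x,0,d,(l_i)_{i=1}^m,\emptyset),$$ where $\emptyset$ is the empty sequence ($u=n=0$). -/

import Mathlib

namespace HalvedHexagon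

/-!
Triangular lattice.  In the coordinates used here a horizontal unit is half the side of a unit
triangle and a vertical unit is its height.  The lattice vertices are the points `(a, b)` of `ℤ × ℤ`
with `a + b` even, two of them being neighbours if they differ by `±(2, 0)`, `±(1, 1)`, `±(1, -1)`.
-/

/-- A unit triangle is given by the pair `(i, j)`, where `j` is the height of its lower side or
lower vertex (so it lies in the strip between heights `j` and `j + 1`) and `i` is the abscissa of
its vertical axis of symmetry. It is up-pointing if `i + j` is odd and down-pointing if `i + j` is
even. -/
abbrev Tri := ℤ × ℤ

/-- The three vertices of a unit triangle. -/
def verts (t : Tri) : Finset (ℤ × ℤ) :=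
  if Odd (t.1 + t.2) then {(t.1 - 1, t.2), (t.1 + 1, t.2), (t.1, t.2 + 1)}
  else {(t.1, t.2), (t.1 - 1, t.2 + 1), (t.1 + 1, t.2 + 1)}

/-- A lozenge is the union of two unit triangles sharing an edge; it is written as the pair
(up-pointing triangle, down-pointing triangle). -/
abbrev Lozenge := Tri × Tri

/-- The lozenges contained in the region `R` (a finite set of unit triangles). The up-pointing
triangle `(i, j)` shares its left, right, lower side with the down-pointing triangle
`(i - 1, j)`, `(i + 1, j)`, `(i, j - 1)`, respectively. -/
def lozenges (R : Finset Tri) : Finset Lozenge :=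
  (R ×ˢ R).filter fun L =>
    Odd (L.1.1 + L.1.2) ∧
      (L.2 = (L.1.1 - 1, L.1.2) ∨ L.2 = (L.1.1 + 1, L.1.2) ∨ L.2 = (L.1.1, L.1.2 - 1))

/-- The lozenge tilings of `R`: the sets of lozenges contained in `R` such that every unit triangle
of `R` belongs to exactly one of them. -/
def tilings (R : Finset Tri) : Finset (Finset Lozenge) :=
  (lozenges R).powerset.filter fun T =>
    ∀ t ∈ R, (T.filter fun L => t = L.1 ∨ t = L.2).card = 1

variable {K : Type*} [Field K]

/-- The symmetric weight of a vertical lozenge with center `(i, j)`. -/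
def wt₁ (q : K) (i _j : ℤ) : K := (q ^ i + q ^ (-i)) / 2

/-- The weight of a lozenge: the symmetric weight for a vertical lozenge (its center is the midpoint
`(i, j)` of the lower side of its up-pointing triangle `(i, j)`), and `1` for any other lozenge. -/
def lozengeWeight (q : K) (L : Lozenge) : K :=
  if L.2 = (L.1.1, L.1.2 - 1) then wt₁ q L.1.1 L.1.2 else 1

/-- The tiling generating function of the region `R` with the symmetric weight. -/
noncomputable def tilingGF (q : K) (R : Finset Tri) : K :=
  ∑ T ∈ tilings R, ∏ L ∈ T, lozengeWeight q L

/-!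
The region of type B.  Its corners are `(1, 2d+1)` (top left), `(2x+1, 2d+1)` (top right),
`(2x+2d-m+2, m)` (east), `(2(x+d-m)+2, 0)` (bottom right) and `(2, 0)` (bottom left), so that its
north, northeast, southeast and south sides have lengths `x`, `2d-m+1`, `m`, `x+d-m`.  From the top,
the west side runs through `(1, 2d+1), (0, 2d), (1, 2d-1), (0, 2d-2), …, (1, 3), (0, 2), (2, 0)`: it
has `2d` steps, the last of length `2` and all others of length `1`, and it touches the vertical
axis, from the right, at the `d` points `(0, 2k)`.
-/

/-- The abscissa of the west side at the integer height `y`. -/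
def west (y : ℤ) : ℤ := if y = 0 then 2 else if Even y then 0 else 1

/-- The abscissa of the east side (northeast side above, southeast side below) at height `y`. -/
noncomputable def east (x d m : ℕ) (y : ℤ) : ℤ :=
  min (2 * x + 1 + (2 * d + 1 - y)) (2 * (x + d - m) + 2 + y)

/-- The unit triangles between heights `0` and `2d + 1` whose vertices lie between the west and the
east side. -/
noncomputable def fullRegion (x d m : ℕ) : Finset Tri :=
  (Finset.Icc (0 : ℤ) (2 * x + 2 * d + 2) ×ˢ Finset.Icc (0 : ℤ) (2 * d)).filter fun t =>
    ∀ v ∈ verts t, west v.2 ≤ v.1 ∧ v.1 ≤ east x d m v.2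

/-- The bounding box in the definition of `fullRegion` does not cut anything off. -/
theorem mem_fullRegion (x d m : ℕ) (t : Tri) :
    t ∈ fullRegion x d m ↔ (0 ≤ t.2 ∧ t.2 ≤ 2 * d) ∧
      ∀ v ∈ verts t, west v.2 ≤ v.1 ∧ v.1 ≤ east x d m v.2 := by
  have hw : ∀ y, 0 ≤ west y := by intro y; unfold west; split_ifs <;> norm_num
  have he : ∀ y, east x d m y ≤ 2 * x + 1 + (2 * d + 1 - y) := fun y => min_le_left _ _
  simp only [fullRegion, Finset.mem_filter, Finset.mem_product, Finset.mem_Icc]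
  refine ⟨fun h => ⟨h.1.2, h.2⟩, fun h => ⟨⟨?_, h.1⟩, h.2⟩⟩
  obtain ⟨⟨h0, h1⟩, h2⟩ := h
  by_cases ho : Odd (t.1 + t.2)
  · have a := h2 (t.1 - 1, t.2) (by simp [verts, ho])
    have b := h2 (t.1 + 1, t.2) (by simp [verts, ho])
    have := hw t.2
    have := he t.2
    simp only at a b
    constructor <;> linarith
  · have a := h2 (t.1, t.2) (by simp [verts, ho])
    have := hw t.2
    have := he t.2
    simp only at a
    constructor <;> linarith

/-- The `k`-th bump from the bottom (`1 ≤ k ≤ d`) is the one with the vertex `(0, 2k)`; the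
up-pointing unit triangle in it has the vertices `(0, 2k)`, `(2, 2k)`, `(1, 2k + 1)`. These are the
triangles at the bumps that do not occur in the list `l`. -/
def dents (d : ℕ) {m : ℕ} (l : Fin m → ℕ) : Finset Tri :=
  (Finset.Icc 1 d \ Finset.univ.image l).image fun k : ℕ => ((1 : ℤ), 2 * (k : ℤ))

/-- The region `B_{x,d}(l_1, …, l_m)`. -/
noncomputable def regionB (x d : ℕ) {m : ℕ} (l : Fin m → ℕ) : Finset Tri :=
  fullRegion x d m \ dents d l

/-! The product formula. -/

/-- The `q`-integer `[n]_p = 1 + p + ⋯ + p^(n-1)`. -/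
def qInt (p : K) (n : ℤ) : K := ∑ k ∈ Finset.range n.toNat, p ^ k

/-- The `q`-factorial `[n]_p! = [1]_p [2]_p ⋯ [n]_p`. -/
noncomputable def qFact (p : K) (n : ℤ) : K := ∏ k ∈ Finset.Icc (1 : ℤ) n, qInt p k

/-- The sum `a + (a + 1) + ⋯ + b`. -/
noncomputable def bracketSum (b a : ℤ) : ℤ := ∑ k ∈ Finset.Icc a b, k

/-- `f(t, x, y) = x y (2t + x - y) / 2`, which is an integer for all integers `t, x, y`. -/
def fExp (t x y : ℤ) : ℤ := x * y * (2 * t + x - y) / 2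

/-- The one-based entry `l_i` of a list is `l (i - 1)`; this is the one-based index `i`. -/
def idx {m : ℕ} (i : Fin m) : ℤ := (i : ℤ) + 1

/-- `e' = min (u - n, d - m + 1)` -/
noncomputable def ePrime (u d m n : ℕ) : ℤ := min ((u : ℤ) - n) ((d : ℤ) - m + 1)

/-- `x̃ = x + u - n + d - m - e'` -/
noncomputable def xTilde (x u d m n : ℕ) : ℤ := (x : ℤ) + u - n + d - m - ePrime u d m n

/-- The exponent `E'`. -/
noncomputable def EPrime (x u d : ℕ) {m n : ℕ} (l : Fin m → ℕ) (h : Fin n → ℕ) : ℤ :=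
  let t₁ : ℤ := 2 * ((x : ℤ) + u - n - ePrime u d m n) + 1
  let t₂ : ℤ := 2 * ((x : ℤ) + d - m + 1 - ePrime u d m n)
  fExp (t₁ + 2 * d - m) (n + 1) m
    + ∑ i : Fin m, bracketSum (t₁ + 2 * d - m - (m - idx i + 1))
        (t₁ + 2 * (d - l i) - 2 * (m - idx i))
    + ∑ i : Fin n, bracketSum (t₂ + 2 * u - n - (n - idx i + 1))
        (t₂ + 2 * (u - h i) - 2 * (n - idx i))

/-- The exponent `F'`. -/
noncomputable def FPrime {m n : ℕ} (l : Fin m → ℕ) (h : Fin n → ℕ) : ℤ :=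
  ((n : ℤ) + 1) * m + ∑ i : Fin m, (2 * (l i : ℤ) - idx i) + ∑ i : Fin n, (2 * (h i : ℤ) - idx i)

/-- The product `Q(x, u, d, (l_i), (h_j))`. -/
noncomputable def Q (q : K) (x u d : ℕ) {m n : ℕ} (l : Fin m → ℕ) (h : Fin n → ℕ) : K :=
  let X : ℤ := xTilde x u d m n
  (2 : K) ^ (-FPrime l h) * q ^ (-EPrime x u d l h)
  * ((∏ j : Fin m, ∏ i ∈ Finset.univ.filter (· < j), qInt (q ^ 2) (2 * ((l j : ℤ) - l i)))
      * (∏ j : Fin n, ∏ i ∈ Finset.univ.filter (· < j), qInt (q ^ 2) (2 * ((h j : ℤ) - h i)))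
    / ((∏ i : Fin m, ∏ j : Fin n, qInt (q ^ 2) (2 * ((l i : ℤ) + h j)))
      * (∏ i : Fin m, qFact (q ^ 2) (2 * (l i : ℤ)))
      * (∏ j : Fin n, qFact (q ^ 2) (2 * (h j : ℤ) - 1))))
  * (∏ i ∈ Finset.Icc (1 : ℤ) (((n : ℤ) + 1) / 2), ∏ j ∈ Finset.Icc (1 : ℤ) (2 * n - 4 * i + 3),
      qInt (q ^ 2) (2 * X + 2 * i + j))
  * (∏ i : Fin m, qInt (q ^ 2) (2 * (X + n + idx i)) * qInt (q ^ 2) (2 * (X + n + idx i + 1)))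
  * (∏ i : Fin m, ∏ j ∈ Finset.Icc (1 : ℤ) (n + idx i - 1),
      qInt (q ^ 2) (2 * X + n + idx i + j + 1))
  * (∏ i : Fin n, ∏ j : Fin m,
      qInt (q ^ 2) (2 * (X + idx i + idx j - 1)) / qInt (q ^ 2) (2 * (X + idx i + idx j - 1) + 1))
  * (∏ i : Fin m, ∏ j ∈ Finset.Icc (1 : ℤ) (l i - idx i),
      qInt (q ^ 2) (2 * (X + idx i + j + n + 1)) * qInt (q ^ 2) (2 * (X - idx i - j + m + 1)))
  * (∏ i : Fin n, ∏ j ∈ Finset.Icc (1 : ℤ) (h i - idx i),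
      qInt (q ^ 2) (2 * (X + idx i + j + m)) * qInt (q ^ 2) (2 * (X - idx i - j + n + 2)))

end HalvedHexagon

/-! A tiling is encoded by `m` non-intersecting lattice paths. Cut the region into strips by the
lines on which `i - j` is a fixed even number. A path starts at each bump that keeps its triangle;
each step moves one strip to the right and either keeps its height (weight `1`) or drops by one
through a vertical lozenge, whose weight depends only on its abscissa. With `X = x + d - m`, the
paths leave through the southeast side, in strip `X + 1`, at the heights `0, …, m - 1`. The lozenges
off the paths are forced.

The determinant of path weights is obtained by peeling off lozenges rather than by a sign-reversing
involution. The up-pointing triangle at the head of a suitable leftmost path has at most two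
possible partners, and this two-term expansion matches the recursion satisfied by one row of the
determinant. A forbidden step gives either two equal rows (a collision) or a zero row (leaving the
region). This is `IsFrontier.tilingGF_eq_det`.

Starting on the west zigzag, the weight of a descent depends only on the number of steps and
descents made so far, so path weights satisfy a Pascal-type recursion with a product solution
(`startWeight_succ`, `pathWeight_start`). Up to row and column factors, each matrix entry is a
product of `m - 1` symmetric differences `q^n - q^(-n)`, and `det_prod_sDiff` evaluates the
determinant by splitting off a Vandermonde matrix. It remains to write the `q`-integers of `Q` as
symmetric differences, check that the powers of `q` and of `2` agree, and match the products. -/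

namespace HalvedHexagon

/-! ### Expansion of the tiling generating function along a triangle -/

section Expansion

variable {K : Type*} [Field K]

theorem mem_lozenges {R : Finset Tri} {L : Lozenge} :
    L ∈ lozenges R ↔ (L.1 ∈ R ∧ L.2 ∈ R) ∧ Odd (L.1.1 + L.1.2) ∧
      (L.2 = (L.1.1 - 1, L.1.2) ∨ L.2 = (L.1.1 + 1, L.1.2) ∨ L.2 = (L.1.1, L.1.2 - 1)) := by
  simp [lozenges]

theorem mem_tilings {R : Finset Tri} {T : Finset Lozenge} :
    T ∈ tilings R ↔ T ⊆ lozenges R ∧ ∀ t ∈ R, ∃! L, L ∈ T ∧ (t = L.1 ∨ t = L.2) := by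
  simp only [tilings, Finset.mem_filter, Finset.mem_powerset]
  refine and_congr_right fun _ => forall₂_congr fun t _ => ?_
  rw [Finset.card_eq_one]
  constructor
  · rintro ⟨L, hL⟩
    refine ⟨L, by simpa using (Finset.ext_iff.1 hL L).2 (by simp), fun L' hL' => ?_⟩
    simpa using (Finset.ext_iff.1 hL L').1 (by simpa using hL')
  · rintro ⟨L, hL, hu⟩
    refine ⟨L, Finset.ext fun L' => ?_⟩
    simp only [Finset.mem_filter, Finset.mem_singleton]
    exact ⟨hu L', fun h => h ▸ hL⟩

/-- With `insert_mem_tilings`, this gives the bijection between tilings that use `L` and tilings of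
the region without `L`, which underlies every expansion below. -/
theorem erase_mem_tilings {R : Finset Tri} {T : Finset Lozenge} {L : Lozenge}
    (hT : T ∈ tilings R) (hL : L ∈ T) : T.erase L ∈ tilings (R \ {L.1, L.2}) := by
  rw [mem_tilings] at hT ⊢
  obtain ⟨hs, hu⟩ := hT
  have key : ∀ L' ∈ T, L' ≠ L → ∀ t ∈ R, (t = L'.1 ∨ t = L'.2) → ¬ (t = L.1 ∨ t = L.2) :=
    fun L' h' hne t ht h1 h2 => hne ((hu t ht).unique ⟨h', h1⟩ ⟨hL, h2⟩)
  constructor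
  · intro L' h'
    obtain ⟨hne, h'⟩ := Finset.mem_erase.1 h'
    have h := mem_lozenges.1 (hs h')
    have h1 := key L' h' hne _ h.1.1 (Or.inl rfl)
    have h2 := key L' h' hne _ h.1.2 (Or.inr rfl)
    rw [mem_lozenges]
    exact ⟨⟨by simpa [h.1.1] using h1, by simpa [h.1.2] using h2⟩, h.2⟩
  · intro t ht
    simp only [Finset.mem_sdiff, Finset.mem_insert, Finset.mem_singleton] at ht
    obtain ⟨L', h', hL'⟩ := hu t ht.1
    refine ⟨L', ⟨Finset.mem_erase.2 ⟨?_, h'.1⟩, h'.2⟩, fun L'' h'' => ?_⟩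
    · rintro rfl
      exact ht.2 h'.2
    · exact hL' L'' ⟨Finset.mem_of_mem_erase h''.1, h''.2⟩

theorem notMem_of_mem_tilings_sdiff {R : Finset Tri} {T : Finset Lozenge} {L : Lozenge}
    (hT : T ∈ tilings (R \ {L.1, L.2})) : L ∉ T := by
  intro h
  have := (mem_lozenges.1 ((mem_tilings.1 hT).1 h)).1.1
  simp at this

theorem insert_mem_tilings {R : Finset Tri} {T : Finset Lozenge} {L : Lozenge}
    (hL : L ∈ lozenges R) (hT : T ∈ tilings (R \ {L.1, L.2})) : insert L T ∈ tilings R := by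
  rw [mem_tilings] at hT ⊢
  obtain ⟨hs, hu⟩ := hT
  constructor
  · intro L' h'
    rcases Finset.mem_insert.1 h' with rfl | h'
    · exact hL
    · have h := mem_lozenges.1 (hs h')
      rw [mem_lozenges]
      exact ⟨⟨(Finset.mem_sdiff.1 h.1.1).1, (Finset.mem_sdiff.1 h.1.2).1⟩, h.2⟩
  · intro t ht
    by_cases htL : t = L.1 ∨ t = L.2
    · refine ⟨L, ⟨Finset.mem_insert_self _ _, htL⟩, ?_⟩
      rintro L' ⟨h', h''⟩
      rcases Finset.mem_insert.1 h' with rfl | h'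
      · rfl
      · have h := mem_lozenges.1 (hs h')
        simp only [Finset.mem_sdiff, Finset.mem_insert, Finset.mem_singleton] at h
        rcases h'' with rfl | rfl
        · exact absurd htL h.1.1.2
        · exact absurd htL h.1.2.2
    · obtain ⟨L', h', hL'⟩ := hu t (by simp [ht, htL])
      refine ⟨L', ⟨Finset.mem_insert_of_mem h'.1, h'.2⟩, ?_⟩
      rintro L'' ⟨h1, h2⟩
      rcases Finset.mem_insert.1 h1 with rfl | h1
      · exact absurd h2 htL
      · exact hL' L'' ⟨h1, h2⟩

/-- Expansion of the tiling generating function along a unit triangle. -/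
theorem tilingGF_eq_sum (q : K) {R : Finset Tri} {t : Tri} (ht : t ∈ R) :
    tilingGF q R = ∑ L ∈ (lozenges R).filter (fun L => t = L.1 ∨ t = L.2),
      lozengeWeight q L * tilingGF q (R \ {L.1, L.2}) := by
  have h1 : tilingGF q R = ∑ T ∈ tilings R,
      ∑ L ∈ (lozenges R).filter (fun L => t = L.1 ∨ t = L.2),
        if L ∈ T then ∏ L ∈ T, lozengeWeight q L else 0 := by
    refine Finset.sum_congr rfl fun T hT => ?_
    obtain ⟨hs, hu⟩ := mem_tilings.1 hT
    obtain ⟨L, hL, hLu⟩ := hu t ht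
    rw [Finset.sum_eq_single_of_mem L (by simp [hs hL.1, hL.2]), if_pos hL.1]
    intro L' h' hne
    rw [if_neg fun h => hne (hLu L' ⟨h, (Finset.mem_filter.1 h').2⟩)]
  rw [h1, Finset.sum_comm]
  refine Finset.sum_congr rfl fun L hL => ?_
  rw [← Finset.sum_filter, tilingGF, Finset.mul_sum]
  refine Finset.sum_bij' (fun T _ => T.erase L) (fun T _ => insert L T) ?_ ?_ ?_ ?_ ?_
  · intro T hT
    exact erase_mem_tilings (Finset.mem_filter.1 hT).1 (Finset.mem_filter.1 hT).2
  · intro T hT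
    exact Finset.mem_filter.2
      ⟨insert_mem_tilings (Finset.mem_filter.1 hL).1 hT, Finset.mem_insert_self _ _⟩
  · intro T hT
    exact Finset.insert_erase (Finset.mem_filter.1 hT).2
  · intro T hT
    exact Finset.erase_insert (notMem_of_mem_tilings_sdiff hT)
  · intro T hT
    exact (Finset.mul_prod_erase _ _ (Finset.mem_filter.1 hT).2).symm

theorem tilingGF_empty (q : K) : tilingGF q ∅ = 1 := by
  have : tilings ∅ = {∅} := by
    ext T
    simp [mem_tilings, lozenges]
  simp [tilingGF, this]

/-- Expansion along an up-pointing triangle whose left neighbour is not in the region. -/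
theorem tilingGF_up (q : K) {R : Finset Tri} {i j : ℤ} (ho : Odd (i + j)) (hu : (i, j) ∈ R)
    (hl : (i - 1, j) ∉ R) :
    tilingGF q R =
      (if (i + 1, j) ∈ R then tilingGF q (R \ {(i, j), (i + 1, j)}) else 0) +
      wt₁ q i j * (if (i, j - 1) ∈ R then tilingGF q (R \ {(i, j), (i, j - 1)}) else 0) := by
  rw [tilingGF_eq_sum q hu]
  have hset : (lozenges R).filter (fun L => (i, j) = L.1 ∨ (i, j) = L.2) =
      ({((i, j), (i + 1, j)), ((i, j), (i, j - 1))} : Finset Lozenge).filter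
        (fun L => L.2 ∈ R) := by
    ext ⟨⟨a, b⟩, ⟨c, e⟩⟩
    simp only [Finset.mem_filter, mem_lozenges, Finset.mem_insert, Finset.mem_singleton,
      Prod.mk.injEq]
    constructor
    · rintro ⟨⟨⟨h1, h2⟩, h3, h4⟩, ⟨rfl, rfl⟩ | ⟨rfl, rfl⟩⟩
      · rcases h4 with ⟨rfl, rfl⟩ | ⟨rfl, rfl⟩ | ⟨rfl, rfl⟩
        · exact absurd h2 hl
        · simp [h2]
        · simp [h2]
      · exfalso
        rw [Int.odd_iff] at h3 ho
        omega
    · rintro ⟨⟨⟨rfl, rfl⟩, rfl, rfl⟩ | ⟨⟨rfl, rfl⟩, rfl, rfl⟩, h⟩ <;> simp [hu, h, ho]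
  rw [hset, Finset.sum_filter, Finset.sum_pair (by simp)]
  simp [lozengeWeight]

/-- A down-pointing triangle with at most a right neighbour in the region. -/
theorem tilingGF_down (q : K) {R : Finset Tri} {i j : ℤ} (he : Even (i + j)) (hd : (i, j) ∈ R)
    (hl : (i - 1, j) ∉ R) (ha : (i, j + 1) ∉ R) (hr : (i + 1, j) ∈ R) :
    tilingGF q R = tilingGF q (R \ {(i + 1, j), (i, j)}) := by
  rw [tilingGF_eq_sum q hd]
  have hset : (lozenges R).filter (fun L => (i, j) = L.1 ∨ (i, j) = L.2) =
      {((i + 1, j), (i, j))} := by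
    ext ⟨⟨a, b⟩, ⟨c, e⟩⟩
    simp only [Finset.mem_filter, mem_lozenges, Finset.mem_singleton, Prod.mk.injEq]
    constructor
    · rintro ⟨⟨⟨h1, h2⟩, h3, h4⟩, ⟨rfl, rfl⟩ | ⟨rfl, rfl⟩⟩
      · exfalso
        rw [Int.odd_iff] at h3
        rw [Int.even_iff] at he
        omega
      · rcases h4 with ⟨h5, h6⟩ | ⟨h5, h6⟩ | ⟨h5, h6⟩
        · exact ⟨⟨by omega, by omega⟩, rfl, rfl⟩
        · exact absurd (by convert h1 using 2; omega) hl
        · exact absurd (by convert h1 using 2; omega) ha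
    · rintro ⟨⟨rfl, rfl⟩, rfl, rfl⟩
      refine ⟨⟨⟨hr, hd⟩, ?_, ?_⟩, ?_⟩
      · rw [Int.even_iff] at he
        rw [Int.odd_iff]
        omega
      · simp
      · simp
  rw [hset, Finset.sum_singleton]
  simp [lozengeWeight]

end Expansion

/-! ### Lattice paths and the determinant formula -/

section Frontier

variable {K : Type*} [Field K]

/-- The up-pointing triangle at height `p.2` in the strip between the lines `i - j = 2 * p.1` and
`i - j = 2 * p.1 + 2`. -/
def upTri (p : ℤ × ℤ) : Tri := (2 * p.1 + 1 + p.2, p.2)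

/-- The down-pointing triangle at height `p.2` in the strip between the lines `i - j = 2 * p.1` and
`i - j = 2 * p.1 + 2`; it is the right neighbour of `upTri p`. -/
def downTri (p : ℤ × ℤ) : Tri := (2 * p.1 + 2 + p.2, p.2)

/-- Translation by one strip to the right: `upTri (shift p)` is the right neighbour of
`downTri p`. -/
def shift (p : ℤ × ℤ) : ℤ × ℤ := (p.1 + 1, p.2)

theorem upTri_injective : Function.Injective upTri := by
  rintro ⟨a, b⟩ ⟨c, e⟩ h
  simp only [upTri, Prod.mk.injEq] at h ⊢
  omega

theorem downTri_injective : Function.Injective downTri := by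
  rintro ⟨a, b⟩ ⟨c, e⟩ h
  simp only [downTri, Prod.mk.injEq] at h ⊢
  omega

theorem upTri_ne_downTri (p p' : ℤ × ℤ) : upTri p ≠ downTri p' := by
  intro h
  simp only [upTri, downTri, Prod.mk.injEq] at h
  omega

theorem exists_upTri_or_downTri (t : Tri) : ∃ p, t = upTri p ∨ t = downTri p := by
  obtain ⟨i, j⟩ := t
  rcases Int.even_or_odd' (i - j) with ⟨c, h | h⟩
  · exact ⟨(c - 1, j), Or.inr (Prod.ext (by simp only [downTri]; omega) rfl)⟩
  · exact ⟨(c, j), Or.inl (Prod.ext (by simp only [upTri]; omega) rfl)⟩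

/-- The region consisting of the down-pointing triangles in `V`, their right neighbours, and the
up-pointing triangles in `A`, without the up-pointing triangles in the strips after `X`. -/
def pathRegion (X : ℤ) (A V : Finset (ℤ × ℤ)) : Finset Tri :=
  ((A ∪ V.image shift).filter fun p => p.1 ≤ X).image upTri ∪ V.image downTri

theorem upTri_mem_pathRegion {X : ℤ} {A V : Finset (ℤ × ℤ)} {p : ℤ × ℤ} :
    upTri p ∈ pathRegion X A V ↔ (p ∈ A ∨ (p.1 - 1, p.2) ∈ V) ∧ p.1 ≤ X := by
  have h : (∃ e ∈ V, shift e = p) ↔ (p.1 - 1, p.2) ∈ V := by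
    constructor
    · rintro ⟨e, he, rfl⟩
      simpa [shift] using he
    · intro h
      exact ⟨_, h, by simp [shift]⟩
  rw [pathRegion, Finset.mem_union, upTri_injective.mem_finset_image, Finset.mem_filter,
    Finset.mem_union, Finset.mem_image, Finset.mem_image, h]
  simp [fun e => (upTri_ne_downTri p e).symm]

theorem downTri_mem_pathRegion {X : ℤ} {A V : Finset (ℤ × ℤ)} {p : ℤ × ℤ} :
    downTri p ∈ pathRegion X A V ↔ p ∈ V := by
  rw [pathRegion, Finset.mem_union, downTri_injective.mem_finset_image]
  simp [fun e => upTri_ne_downTri e p]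

theorem finset_tri_ext {R R' : Finset Tri} (hu : ∀ p, upTri p ∈ R ↔ upTri p ∈ R')
    (hd : ∀ p, downTri p ∈ R ↔ downTri p ∈ R') : R = R' := by
  ext t
  obtain ⟨p, rfl | rfl⟩ := exists_upTri_or_downTri t
  · exact hu p
  · exact hd p

/-- Removing `downTri e` leaves its right neighbour without its left partner, so `shift e` has to be
listed among the path heads. The first hypothesis ensures that `upTri u` belongs to the region, if
at all, only through `A`. -/
theorem pathRegion_sdiff {X : ℤ} {A V : Finset (ℤ × ℤ)} {u e : ℤ × ℤ}
    (hu : (u.1 - 1, u.2) ∉ V) (he : e ∈ V) :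
    pathRegion X A V \ {upTri u, downTri e} =
      pathRegion X (insert (shift e) (A.erase u)) (V.erase e) := by
  refine finset_tri_ext (fun p => ?_) (fun p => ?_)
  · simp only [Finset.mem_sdiff, upTri_mem_pathRegion, Finset.mem_insert, Finset.mem_singleton,
      upTri_injective.eq_iff, upTri_ne_downTri, or_false, Finset.mem_erase]
    have h1 : p = shift e ↔ (p.1 - 1, p.2) = e := by
      obtain ⟨a, b⟩ := p
      obtain ⟨c, d⟩ := e
      simp only [shift, Prod.mk.injEq]
      omega
    have h2 : p = u → (p.1 - 1, p.2) ∉ V := by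
      rintro rfl
      exact hu
    have h3 : (p.1 - 1, p.2) = e → (p.1 - 1, p.2) ∈ V := by
      rintro h
      rwa [h]
    rw [h1]
    tauto
  · simp only [Finset.mem_sdiff, downTri_mem_pathRegion, Finset.mem_insert, Finset.mem_singleton,
      downTri_injective.eq_iff, (upTri_ne_downTri _ _).symm, false_or, Finset.mem_erase]
    tauto

/-- A region that consists of down-pointing triangles and their right neighbours only has exactly
one tiling. -/
theorem tilingGF_pathRegion_pairs (q : K) {X : ℤ} {A : Finset (ℤ × ℤ)} (hA : ∀ p ∈ A, X < p.1)
    (V : Finset (ℤ × ℤ)) (hV : ∀ p ∈ V, p.1 < X) : tilingGF q (pathRegion X A V) = 1 := by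
  induction hn : V.card generalizing V with
  | zero =>
    obtain rfl := Finset.card_eq_zero.1 hn
    have : pathRegion X A ∅ = ∅ := by
      refine finset_tri_ext (fun p => ?_) (fun p => ?_)
      · simp only [upTri_mem_pathRegion, Finset.notMem_empty, or_false, iff_false, not_and]
        intro h
        exact not_le.2 (hA p h)
      · simp [downTri_mem_pathRegion]
    rw [this, tilingGF_empty]
  | succ n ih =>
    -- In the leftmost occupied strip, a down-pointing triangle has neither its left nor its upper
    -- neighbour in the region, so its lozenge is forced.
    obtain ⟨e, he, hmin⟩ := V.exists_min_image (fun p => p.1) (Finset.card_pos.1 (by omega))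
    have hAe : A.erase (shift e) = A := by
      refine Finset.erase_eq_of_notMem fun h => ?_
      have := hA _ h
      have := hV e he
      simp only [shift] at *
      omega
    have hnot : ∀ j, upTri (e.1, j) ∉ pathRegion X A V := by
      intro j h
      obtain ⟨h | h, -⟩ := upTri_mem_pathRegion.1 h
      · exact absurd (hA _ h) (not_lt.2 (hV e he).le)
      · have := hmin _ h
        simp only at this
        omega
    have key := tilingGF_down q (R := pathRegion X A V) (i := 2 * e.1 + 2 + e.2) (j := e.2)
      ⟨e.1 + 1 + e.2, by ring⟩ (downTri_mem_pathRegion.2 he)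
      (by convert hnot e.2 using 2; exact Prod.ext (by simp only [upTri]; omega) rfl)
      (by convert hnot (e.2 + 1) using 2; exact Prod.ext (by simp only [upTri]; omega) rfl)
      (by
        convert (upTri_mem_pathRegion (X := X) (A := A) (V := V) (p := shift e)).2
          ⟨Or.inr (by simpa [shift] using he), hV e he⟩ using 1
        exact Prod.ext (by simp only [upTri, shift]; omega) rfl)
    rw [key, ← ih (V.erase e) (fun p hp => hV p (Finset.mem_of_mem_erase hp))
      (by rw [Finset.card_erase_of_mem he, hn]; rfl)]
    congr 1
    refine finset_tri_ext (fun p => ?_) (fun p => ?_)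
    · have h0 : ((2 * e.1 + 2 + e.2 + 1, e.2) : Tri) = upTri (shift e) := by
        exact Prod.ext (by simp only [upTri, shift]; omega) rfl
      have h0' : ((2 * e.1 + 2 + e.2, e.2) : Tri) = downTri e := rfl
      have h1 : p = shift e ↔ (p.1 - 1, p.2) = e := by
        obtain ⟨a, b⟩ := p
        obtain ⟨c, d⟩ := e
        simp only [shift, Prod.mk.injEq]
        omega
      have h2 : p = shift e → p ∉ A := by
        rintro rfl h
        have := hA _ h
        have := hV e he
        simp only [shift] at *
        omega
      rw [h0, h0']
      simp only [Finset.mem_sdiff, upTri_mem_pathRegion, Finset.mem_insert, Finset.mem_singleton,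
        upTri_injective.eq_iff, upTri_ne_downTri, or_false, Finset.mem_erase]
      rw [h1] at h2 ⊢
      tauto
    · have h0 : ((2 * e.1 + 2 + e.2 + 1, e.2) : Tri) = upTri (shift e) := by
        exact Prod.ext (by simp only [upTri, shift]; omega) rfl
      have h0' : ((2 * e.1 + 2 + e.2, e.2) : Tri) = downTri e := rfl
      rw [h0, h0']
      simp only [Finset.mem_sdiff, downTri_mem_pathRegion, Finset.mem_insert,
        Finset.mem_singleton, downTri_injective.eq_iff, (upTri_ne_downTri _ _).symm, false_or,
        Finset.mem_erase]
      tauto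

/-- The two terms are the two possible steps of the path at `u`: level, or down through a vertical
lozenge. -/
theorem tilingGF_pathRegion_step (q : K) {X : ℤ} {A V : Finset (ℤ × ℤ)} {u : ℤ × ℤ} (hu : u ∈ A)
    (hX : u.1 ≤ X) (hl : (u.1 - 1, u.2) ∉ V) :
    tilingGF q (pathRegion X A V) =
      (if u ∈ V then tilingGF q (pathRegion X (insert (shift u) (A.erase u)) (V.erase u))
        else 0) +
      wt₁ q (2 * u.1 + 1 + u.2) 0 * (if (u.1, u.2 - 1) ∈ V then
        tilingGF q (pathRegion X (insert (shift (u.1, u.2 - 1)) (A.erase u))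
          (V.erase (u.1, u.2 - 1))) else 0) := by
  have h1 : ((2 * u.1 + 1 + u.2 + 1, u.2) : Tri) = downTri u := by
    exact Prod.ext (by simp only [downTri]; omega) rfl
  have h2 : ((2 * u.1 + 1 + u.2, u.2 - 1) : Tri) = downTri (u.1, u.2 - 1) := by
    exact Prod.ext (by simp only [downTri]; omega) rfl
  have h3 : ((2 * u.1 + 1 + u.2 - 1, u.2) : Tri) = downTri (u.1 - 1, u.2) := by
    exact Prod.ext (by simp only [downTri]; omega) rfl
  have h4 : ((2 * u.1 + 1 + u.2, u.2) : Tri) = upTri u := rfl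
  rw [tilingGF_up q (i := 2 * u.1 + 1 + u.2) (j := u.2) ⟨u.1 + u.2, by ring⟩
    (upTri_mem_pathRegion.2 ⟨Or.inl hu, hX⟩) (by rwa [h3, downTri_mem_pathRegion]), h1, h2, h4]
  simp only [downTri_mem_pathRegion]
  congr 1
  · split_ifs with h
    · rw [pathRegion_sdiff hl h]
    · rfl
  · congr 1
    split_ifs with h
    · rw [pathRegion_sdiff hl h]
    · rfl

/-- `stepIter q X φ n j` is the sum of `φ (end height)` over the weighted lattice paths that start
at height `j` in the strip `X + 1 - n` and end in the strip `X + 1`. -/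
def stepIter (q : K) (X : ℤ) (φ : ℤ → K) : ℕ → ℤ → K
  | 0, j => φ j
  | n + 1, j => stepIter q X φ n j + wt₁ q (2 * (X - n) + 1 + j) 0 * stepIter q X φ n (j - 1)

/-- Paths of `n` steps from height `j` end between the heights `j - n` and `j`. -/
theorem stepIter_eq_zero (q : K) (X : ℤ) {φ : ℤ → K} (n : ℕ) (j : ℤ)
    (h : ∀ y, j - n ≤ y → y ≤ j → φ y = 0) : stepIter q X φ n j = 0 := by
  induction n generalizing j with
  | zero => exact h j (by simp) le_rfl
  | succ n ih =>
    rw [stepIter, ih j fun y h1 h2 => h y (by push_cast; omega) h2,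
      ih (j - 1) fun y h1 h2 => h y (by push_cast; omega) (by omega)]
    simp

/-- The weight of the lattice paths from `p` to the height `y` in the strip `X + 1`. -/
def pathWeight (q : K) (X : ℤ) (p : ℤ × ℤ) (y : ℤ) : K :=
  stepIter q X (fun j => if j = y then 1 else 0) (X + 1 - p.1).toNat p.2

theorem pathWeight_eq_add (q : K) {X : ℤ} {p : ℤ × ℤ} (h : p.1 ≤ X) (y : ℤ) :
    pathWeight q X p y = pathWeight q X (shift p) y +
      wt₁ q (2 * p.1 + 1 + p.2) 0 * pathWeight q X (shift (p.1, p.2 - 1)) y := by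
  have h1 : (X + 1 - p.1).toNat = (X + 1 - (p.1 + 1)).toNat + 1 := by omega
  have h2 : X - ((X + 1 - (p.1 + 1)).toNat : ℤ) = p.1 := by omega
  simp only [pathWeight, shift, h1, stepIter, h2]

/-- The down-pointing triangles of the region that is bounded on the right by the lines
`p.1 = X + 1` and `p.1 + p.2 = X + m`. -/
def InBounds (X : ℤ) (d m : ℕ) (p : ℤ × ℤ) : Prop :=
  0 ≤ p.2 ∧ p.2 ≤ 2 * d ∧ -1 ≤ 2 * p.1 + p.2 ∧ p.1 + p.2 ≤ X + m - 1 ∧ p.1 ≤ X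

/-- A frontier of a partially tiled region: `a k` is the position of the `k`-th path, and `V` is
the set of the down-pointing triangles that are not yet covered. -/
structure IsFrontier (X : ℤ) (d : ℕ) {m : ℕ} (a : Fin m → ℤ × ℤ) (V : Finset (ℤ × ℤ)) : Prop where
  inBounds : ∀ e ∈ V, InBounds X d m e
  height_mono : Monotone fun k => (a k).2
  sum_strictMono : StrictMono fun k => (a k).1 + (a k).2
  pos_inBounds : ∀ k, (a k).1 ≤ X + 1 ∧ 0 ≤ (a k).2 ∧ (a k).2 ≤ 2 * d ∧
    0 ≤ 2 * (a k).1 + (a k).2 ∧ (a k).1 + (a k).2 ≤ X + m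
  left_notMem : ∀ k, ((a k).1 - 1, (a k).2) ∉ V
  missing : ∀ e, InBounds X d m e → e ∉ V → (∃ k, a k = shift e) ∨ ∀ k, e.1 < (a k).1

theorem IsFrontier.injective {X : ℤ} {d m : ℕ} {a : Fin m → ℤ × ℤ} {V : Finset (ℤ × ℤ)}
    (h : IsFrontier X d a V) : Function.Injective a := fun k k' hk =>
  h.sum_strictMono.injective (by simp only [hk])

/-- The last one of the leftmost paths makes a step. -/
theorem IsFrontier.step {X : ℤ} {d m : ℕ} {a : Fin m → ℤ × ℤ} {V : Finset (ℤ × ℤ)}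
    (h : IsFrontier X d a V) {k : Fin m} (hmin : ∀ k', (a k).1 ≤ (a k').1)
    (hlast : ∀ k', k < k' → (a k).1 < (a k').1) {e : ℤ × ℤ} (he : e ∈ V)
    (hek : e.1 = (a k).1 ∧ (e.2 = (a k).2 ∨ e.2 = (a k).2 - 1)) :
    IsFrontier X d (Function.update a k (shift e)) (V.erase e) := by
  obtain ⟨b1, b2, b3, b4, b5⟩ := h.inBounds e he
  have hupd : ∀ k', k' ≠ k → Function.update a k (shift e) k' = a k' := fun k' hk' =>
    Function.update_of_ne hk' _ _
  refine ⟨fun e' he' => h.inBounds e' (Finset.mem_of_mem_erase he'), ?_, ?_, ?_, ?_, ?_⟩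
  · intro i i' hii
    rcases hii.eq_or_lt with rfl | hlt
    · exact le_rfl
    have hm := h.height_mono hii
    have hs := h.sum_strictMono hlt
    simp only at hm hs ⊢
    by_cases hi : i = k
    · subst hi
      rw [Function.update_self, hupd _ hlt.ne']
      simp only [shift]
      omega
    · rw [hupd _ hi]
      by_cases hi' : i' = k
      · subst hi'
        have := hmin i
        rw [Function.update_self]
        simp only [shift]
        omega
      · rwa [hupd _ hi']
  · intro i i' hlt
    have hm := h.height_mono hlt.le
    have hs := h.sum_strictMono hlt
    simp only at hm hs ⊢
    by_cases hi : i = k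
    · subst hi
      rw [Function.update_self, hupd _ hlt.ne']
      have h1 := hlast i' hlt
      -- Equality of the new sums, together with monotone heights, would force path `i'` to stand at
      -- `shift e`. Its left neighbour `e` would then be covered already.
      have h2 := h.left_notMem i'
      have h3 : ((a i').1 - 1, (a i').2) ≠ e := fun h3 => h2 (h3 ▸ he)
      simp only [shift]
      by_contra hc
      refine h3 (Prod.ext ?_ ?_) <;> simp only <;> omega
    · rw [hupd _ hi]
      by_cases hi' : i' = k
      · subst hi'
        rw [Function.update_self]
        simp only [shift]
        omega
      · rwa [hupd _ hi']
  · intro i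
    by_cases hi : i = k
    · subst hi
      rw [Function.update_self]
      simp only [shift]
      omega
    · rw [hupd _ hi]
      exact h.pos_inBounds i
  · intro i
    by_cases hi : i = k
    · subst hi
      rw [Function.update_self]
      simp [shift]
    · rw [hupd _ hi]
      exact fun h' => h.left_notMem i (Finset.mem_of_mem_erase h')
  · intro e' hb he'
    by_cases hee : e' = e
    · exact Or.inl ⟨k, by rw [Function.update_self, hee]⟩
    · have he'' : e' ∉ V := fun h' => he' (Finset.mem_erase.2 ⟨hee, h'⟩)
      have hle : ∀ i, (a i).1 ≤ (Function.update a k (shift e) i).1 := by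
        intro i
        by_cases hi : i = k
        · subst hi
          rw [Function.update_self]
          simp only [shift]
          omega
        · rw [hupd _ hi]
      rcases h.missing e' hb he'' with ⟨i, hi⟩ | h'
      -- If path `k` itself had just left `e'`, then `e'` lies one strip before the leftmost paths
      -- and hence to the left of all of them.
      · by_cases hik : i = k
        · right
          subst hik
          intro i'
          have h1 := congrArg Prod.fst hi
          have h2 := hmin i'
          have h3 := hle i'
          simp only [shift] at h1
          omega
        · exact Or.inl ⟨i, by rw [hupd _ hik, hi]⟩
      · exact Or.inr fun i => (h' i).trans_le (hle i)

theorem image_update {m : ℕ} {α : Type*} [DecidableEq α] {a : Fin m → α}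
    (ha : Function.Injective a) (k : Fin m) (b : α) :
    Finset.univ.image (Function.update a k b) = insert b ((Finset.univ.image a).erase (a k)) := by
  ext p
  simp only [Finset.mem_image, Finset.mem_univ, true_and, Finset.mem_insert, Finset.mem_erase]
  constructor
  · rintro ⟨i, rfl⟩
    by_cases hi : i = k
    · subst hi
      simp
    · rw [Function.update_of_ne hi]
      exact Or.inr ⟨fun h => hi (ha h), i, rfl⟩
  · rintro (rfl | ⟨h1, i, rfl⟩)
    · exact ⟨k, Function.update_self ..⟩
    · exact ⟨i, Function.update_of_ne (fun h => h1 (congrArg a h)) _ _⟩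

theorem eq_of_strictMono_of_bounds {m : ℕ} {h : Fin m → ℤ} (hs : StrictMono h) (h0 : ∀ k, 0 ≤ h k)
    (h1 : ∀ k, h k < m) (k : Fin m) : h k = k := by
  have h2 : StrictMono fun k : Fin m => (⟨(h k).toNat, by have := h1 k; have := h0 k; omega⟩ :
      Fin m) := by
    intro i j hij
    have := hs hij
    have := h0 i
    have := h0 j
    simp only [Fin.mk_lt_mk]
    omega
  have h3 := congrFun ((h2.range_inj strictMono_id).1 (by
    rw [Set.range_id, (Finite.surjective_of_injective h2.injective).range_eq])) k
  have h4 := congrArg Fin.val h3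
  have := h0 k
  simp only [id] at h4
  omega

/-- A determinantal formula for the tiling generating function. -/
theorem IsFrontier.tilingGF_eq_det (q : K) {X : ℤ} {d m : ℕ} {a : Fin m → ℤ × ℤ}
    {V : Finset (ℤ × ℤ)} (h : IsFrontier X d a V) :
    tilingGF q (pathRegion X (Finset.univ.image a) V) =
      (Matrix.of fun k y : Fin m => pathWeight q X (a k) y).det := by
  -- The induction is on the total number of strips that the paths still have to cross.
  induction hn : ∑ k, (X + 1 - (a k).1).toNat using Nat.strong_induction_on generalizing a V with
  | _ n ih =>
  by_cases hend : ∀ k, (a k).1 = X + 1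
  · have hht : ∀ k, (a k).2 = k := by
      refine eq_of_strictMono_of_bounds ?_ ?_ ?_
      · intro i j hij
        have := h.sum_strictMono hij
        have h1 := hend i
        have h2 := hend j
        simp only at this ⊢
        omega
      · exact fun k => (h.pos_inBounds k).2.1
      · intro k
        have h1 := hend k
        have h2 := h.pos_inBounds k
        omega
    rw [tilingGF_pathRegion_pairs]
    · have : (Matrix.of fun k y : Fin m => pathWeight q X (a k) y) = 1 := by
        ext k y
        simp [pathWeight, hend k, hht k, stepIter, Matrix.one_apply, Fin.ext_iff]
      rw [this, Matrix.det_one]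
    · intro p hp
      obtain ⟨k, -, rfl⟩ := Finset.mem_image.1 hp
      rw [hend k]
      omega
    · intro e he
      have hb := h.inBounds e he
      obtain ⟨b1, b2, b3, b4, b5⟩ := hb
      -- In strip `X` the bounds give a height below `m`, so such a triangle would be the left
      -- neighbour of one of the `m` final positions.
      refine lt_of_le_of_ne b5 fun heX => ?_
      refine h.left_notMem ⟨e.2.toNat, by omega⟩ ?_
      convert he using 1
      refine Prod.ext ?_ ?_
      · simp only [hend]
        omega
      · simp only [hht]
        omega
  · push Not at hend
    obtain ⟨k0, hk0⟩ := hend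
    obtain ⟨k1, -, hk1⟩ := Finset.univ.exists_min_image (fun k => (a k).1) ⟨k0, Finset.mem_univ _⟩
    -- Among the leftmost paths the one with the largest index moves, so all paths of larger index
    -- are strictly ahead and `IsFrontier.step` applies.
    obtain ⟨k, hk, hkmax⟩ := (Finset.univ.filter fun k => (a k).1 = (a k1).1).exists_max_image id
      ⟨k1, by simp⟩
    simp only [Finset.mem_filter, Finset.mem_univ, true_and, id] at hk hkmax
    have hmin : ∀ k', (a k).1 ≤ (a k').1 := fun k' => hk ▸ hk1 k' (Finset.mem_univ _)
    have hlast : ∀ k', k < k' → (a k).1 < (a k').1 := fun k' hlt =>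
      lt_of_le_of_ne (hmin k') fun heq => absurd (hkmax k' (heq ▸ hk)) (not_le.2 hlt)
    have hkX : (a k).1 ≤ X := by
      have := hmin k0
      have := (h.pos_inBounds k0).1
      omega
    set M : Matrix (Fin m) (Fin m) K := Matrix.of fun k y : Fin m => pathWeight q X (a k) y
    -- Each possible step corresponds to replacing row `k`; when the step is unavailable, the new
    -- determinant has to vanish.
    have hrow : ∀ e : ℤ × ℤ, e.1 = (a k).1 ∧ (e.2 = (a k).2 ∨ e.2 = (a k).2 - 1) →
        (if e ∈ V then tilingGF q (pathRegion X
          (insert (shift e) ((Finset.univ.image a).erase (a k))) (V.erase e)) else 0) =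
        (M.updateRow k fun y => pathWeight q X (shift e) y).det := by
      intro e hek
      split_ifs with he
      · rw [← image_update h.injective]
        rw [ih _ _ (h.step hmin hlast he hek) rfl]
        · congr 1
          ext i y
          by_cases hi : i = k
          · subst hi
            simp
          · simp [hi, M]
        · rw [← hn]
          refine Finset.sum_lt_sum (fun i _ => ?_) ⟨k, Finset.mem_univ _, ?_⟩
          · by_cases hi : i = k
            · subst hi
              rw [Function.update_self]
              simp only [shift]
              omega
            · rw [Function.update_of_ne hi]
          · rw [Function.update_self]
            simp only [shift]
            omega
      · by_cases hb : InBounds X d m e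
        · rcases h.missing e hb he with ⟨k', hk'⟩ | h'
          -- Collision: path `k'` already stands where path `k` would arrive, so two rows coincide.
          · have hne : k ≠ k' := by
              rintro rfl
              have := congrArg Prod.fst hk'
              simp only [shift] at this
              omega
            refine (Matrix.det_zero_of_row_eq hne ?_).symm
            rw [Matrix.updateRow_self, Matrix.updateRow_ne hne.symm]
            ext y
            simp [M, hk']
          · exact absurd (h' k) (by omega)
        -- Outside the bounds the path is either below height `0` or too high to come down below
        -- height `m` in the remaining strips, so the row is zero.
        · refine (Matrix.det_eq_zero_of_row_eq_zero k fun y => ?_).symm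
          rw [Matrix.updateRow_self]
          refine stepIter_eq_zero _ _ _ _ fun z h1 h2 => if_neg ?_
          rintro rfl
          have := h.pos_inBounds k
          simp only [shift] at h1 h2
          refine hb ⟨?_, ?_, ?_, ?_, ?_⟩ <;> omega
    rw [tilingGF_pathRegion_step q (Finset.mem_image_of_mem a (Finset.mem_univ k)) hkX
      (h.left_notMem k), hrow (a k) (by simp), hrow ((a k).1, (a k).2 - 1) (by simp),
      ← Matrix.det_updateRow_smul, ← Matrix.det_updateRow_add]
    congr 1
    ext i y
    by_cases hi : i = k
    · subst hi
      simp [M, pathWeight_eq_add q hkX]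
    · simp [hi]

end Frontier

/-! ### Closed form of the path weights -/

section ClosedForm

variable {K : Type*} [Field K]

/-- The symmetric difference `q^n - q^(-n)`. -/
def sDiff (q : K) (n : ℤ) : K := q ^ n - q ^ (-n)

theorem sDiff_zero (q : K) : sDiff q 0 = 0 := by simp [sDiff]

/-- The analogue of `sinh (a + b) - sinh (a - b) = 2 sinh b cosh a`; it is what makes the symmetric
weight summable in closed form. -/
theorem sDiff_add_sub_sDiff {q : K} (hq : q ≠ 0) (h2 : (2 : K) ≠ 0) (a b : ℤ) :
    sDiff q (a + b) - sDiff q (a - b) = 2 * sDiff q b * wt₁ q a 0 := by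
  simp only [sDiff, wt₁, neg_add, neg_sub, zpow_add₀ hq, zpow_sub₀ hq, zpow_neg]
  have h1 : q ^ a ≠ 0 := zpow_ne_zero _ hq
  have h2 : q ^ b ≠ 0 := zpow_ne_zero _ hq
  field_simp
  ring

/-- The product of the `sDiff q t` with `1 ≤ t ≤ n`. -/
def sFact (q : K) (n : ℕ) : K := ∏ t ∈ Finset.range n, sDiff q (t + 1)

/-- The product of the `sDiff q (2 * t)` with `1 ≤ t ≤ n`. -/
def sFactTwo (q : K) (n : ℕ) : K := ∏ t ∈ Finset.range n, sDiff q (2 * (t + 1))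

/-- The weight of the lattice paths with `n` steps, `k` of them downwards, that start on the west
side. -/
noncomputable def startWeight (q : K) (n k : ℕ) : K :=
  (∏ t ∈ Finset.range k, sDiff q (2 * (n - k + t + 1))) / (2 ^ k * sFact q k)

theorem startWeight_zero (q : K) (n : ℕ) : startWeight q n 0 = 1 := by
  simp [startWeight, sFact]

theorem startWeight_eq_zero (q : K) {n k : ℕ} (h : n < k) : startWeight q n k = 0 := by
  rw [startWeight, Finset.prod_eq_zero (i := k - n - 1) (by simp; omega), zero_div]
  rw [show (2 * ((n : ℤ) - k + ((k - n - 1 : ℕ) : ℤ) + 1)) = 0 by omega, sDiff_zero]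

/-- Pascal's rule for the last step. All three terms share a product of `k` factors; what remains is
`sDiff_add_sub_sDiff` with `a = 2n + 1 - k` and `b = k + 1`. -/
theorem startWeight_succ {q : K} (hq : q ≠ 0) (h2 : (2 : K) ≠ 0)
    (hs : ∀ n : ℕ, sDiff q (n + 1) ≠ 0) (n k : ℕ) :
    startWeight q (n + 1) (k + 1) =
      startWeight q n (k + 1) + wt₁ q (2 * n + 1 - k) 0 * startWeight q n k := by
  have hk : sFact q k ≠ 0 := Finset.prod_ne_zero_iff.2 fun t _ => hs t
  have h1 : ∏ t ∈ Finset.range (k + 1), sDiff q (2 * (((n + 1 : ℕ) : ℤ) - (k + 1 : ℕ) + t + 1)) =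
      (∏ t ∈ Finset.range k, sDiff q (2 * ((n : ℤ) - k + t + 1))) *
        sDiff q ((2 * n + 1 - k) + (k + 1)) := by
    rw [Finset.prod_range_succ]
    congr 1
    · refine Finset.prod_congr rfl fun t _ => ?_
      congr 1
      push_cast
      ring
    · congr 1
      push_cast
      ring
  have h3 : ∏ t ∈ Finset.range (k + 1), sDiff q (2 * ((n : ℤ) - (k + 1 : ℕ) + t + 1)) =
      (∏ t ∈ Finset.range k, sDiff q (2 * ((n : ℤ) - k + t + 1))) *
        sDiff q ((2 * n + 1 - k) - (k + 1)) := by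
    rw [Finset.prod_range_succ']
    congr 1
    · refine Finset.prod_congr rfl fun t _ => ?_
      congr 1
      push_cast
      ring
    · congr 1
      push_cast
      ring
  have h4 : sFact q (k + 1) = sFact q k * sDiff q (k + 1) := Finset.prod_range_succ _ _
  have h5 := sDiff_add_sub_sDiff hq h2 (2 * n + 1 - k) (k + 1)
  have h6 := hs k
  rw [sub_eq_iff_eq_add] at h5
  rw [startWeight, startWeight, startWeight, h1, h3, h4, h5]
  field_simp
  ring

/-- `stepIter` recurses on the first step, `startWeight_succ` on the last. Cutting the paths after
`n` steps reconciles the two; `hj` places the start on the west side. -/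
theorem stepIter_eq_sum {q : K} (hq : q ≠ 0) (h2 : (2 : K) ≠ 0)
    (hs : ∀ n : ℕ, sDiff q (n + 1) ≠ 0) (X : ℤ) (φ : ℤ → K) (N : ℕ) {j : ℤ}
    (hj : 2 * (X + 1 - N) + j = 0) (n : ℕ) (hn : n ≤ N) :
    stepIter q X φ N j =
      ∑ k ∈ Finset.range (n + 1), startWeight q n k * stepIter q X φ (N - n) (j - k) := by
  induction n with
  | zero => simp [startWeight_zero]
  | succ n ih =>
    have hN : N - n = (N - (n + 1)) + 1 := by omega
    -- After `n` steps with `k` descents the abscissa is `2n + 1 - k`, whatever the starting bump.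
    have hw : ∀ k : ℕ, 2 * (X - ((N - (n + 1) : ℕ) : ℤ)) + 1 + (j - k) = 2 * n + 1 - k := by
      intro k
      omega
    rw [ih (by omega)]
    simp only [hN, stepIter, hw, mul_add, Finset.sum_add_distrib]
    have h1 : ∑ k ∈ Finset.range (n + 1), startWeight q n k * stepIter q X φ (N - (n + 1)) (j - k) =
        ∑ k ∈ Finset.range (n + 2),
          startWeight q n k * stepIter q X φ (N - (n + 1)) (j - k) := by
      rw [Finset.sum_range_succ _ (n + 1), startWeight_eq_zero q (Nat.lt_succ_self n)]
      simp
    rw [h1, Finset.sum_range_succ' _ (n + 1), Finset.sum_range_succ' _ (n + 1),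
      startWeight_zero, startWeight_zero, add_right_comm, ← Finset.sum_add_distrib]
    congr 1
    refine Finset.sum_congr rfl fun k _ => ?_
    rw [startWeight_succ hq h2 hs]
    have : j - ((k + 1 : ℕ) : ℤ) = j - k - 1 := by push_cast; ring
    rw [this]
    ring

theorem pathWeight_start {q : K} (hq : q ≠ 0) (h2 : (2 : K) ≠ 0)
    (hs : ∀ n : ℕ, sDiff q (n + 1) ≠ 0) (X l y : ℕ) :
    pathWeight q X (-l, 2 * l) y = if y ≤ 2 * l then startWeight q (X + 1 + l) (2 * l - y) else 0 := by
  have hN : ((X : ℤ) + 1 - -(l : ℤ)).toNat = X + 1 + l := by omega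
  simp only [pathWeight, hN]
  rw [stepIter_eq_sum hq h2 hs X _ (X + 1 + l) (by push_cast; ring) (X + 1 + l) le_rfl]
  simp only [Nat.sub_self, stepIter, mul_ite, mul_one, mul_zero]
  split_ifs with hy
  · by_cases hk : 2 * l - y < X + 1 + l + 1
    · rw [Finset.sum_eq_single_of_mem (2 * l - y) (Finset.mem_range.2 hk)]
      · rw [if_pos (by omega)]
      · intro k _ hne
        rw [if_neg (by omega)]
    · rw [startWeight_eq_zero q (by omega)]
      refine Finset.sum_eq_zero fun k hk' => if_neg ?_
      have := Finset.mem_range.1 hk'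
      omega
  · exact Finset.sum_eq_zero fun k _ => if_neg (by omega)

theorem sFact_add (q : K) (a b : ℕ) :
    sFact q (a + b) = sFact q a * ∏ t ∈ Finset.range b, sDiff q ((a + b : ℕ) - t) := by
  rw [sFact, Finset.prod_range_add, ← Finset.prod_range_reflect _ b]
  congr 1
  refine Finset.prod_congr rfl fun t ht => ?_
  have := Finset.mem_range.1 ht
  congr 1
  push_cast
  omega

theorem sFactTwo_add (q : K) (a b : ℕ) :
    sFactTwo q (a + b) = sFactTwo q a * ∏ t ∈ Finset.range b, sDiff q (2 * (a + t + 1)) := by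
  rw [sFactTwo, Finset.prod_range_add]
  push_cast
  rfl

theorem sFact_ne_zero {q : K} (hs : ∀ n : ℕ, sDiff q (n + 1) ≠ 0) (n : ℕ) : sFact q n ≠ 0 :=
  Finset.prod_ne_zero_iff.2 fun t _ => hs t

theorem sFactTwo_ne_zero {q : K} (hs : ∀ n : ℕ, sDiff q (n + 1) ≠ 0) (n : ℕ) :
    sFactTwo q n ≠ 0 :=
  Finset.prod_ne_zero_iff.2 fun t _ => by
    have := hs (2 * t + 1)
    rwa [show (((2 * t + 1 : ℕ) : ℤ) + 1) = 2 * (t + 1) by push_cast; ring] at this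

/-- The path weights, up to a row factor and a column factor. -/
theorem pathWeight_start_eq_mul {q : K} (hq : q ≠ 0) (h2 : (2 : K) ≠ 0)
    (hs : ∀ n : ℕ, sDiff q (n + 1) ≠ 0) {X l m y : ℕ} (hl : l ≤ X + m) (hy : y < m) :
    pathWeight q X (-l, 2 * l) y =
      sFactTwo q (X + 1 + l) / (sFactTwo q (X + m - l) * sFact q (2 * l) * 2 ^ (2 * l)) * 2 ^ y *
        ∏ u ∈ Finset.range (m - 1),
          if u < y then sDiff q (2 * l - u) else sDiff q (2 * (X + 2 + u) - 2 * l) := by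
  rw [pathWeight_start hq h2 hs]
  split_ifs with hyl
  · have hsplit : ∏ u ∈ Finset.range (m - 1),
        (if u < y then sDiff q (2 * l - u) else sDiff q (2 * (X + 2 + u) - 2 * l)) =
        (∏ u ∈ Finset.range y, sDiff q (2 * l - u)) *
          ∏ v ∈ Finset.range (m - 1 - y), sDiff q (2 * (X + 2 + (y + v) - l)) := by
      conv_lhs => rw [show m - 1 = y + (m - 1 - y) by omega, Finset.prod_range_add]
      congr 1
      · exact Finset.prod_congr rfl fun u hu => if_pos (Finset.mem_range.1 hu)
      · refine Finset.prod_congr rfl fun u hu => ?_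
        rw [if_neg (by omega)]
        congr 1
        push_cast
        ring
    have hfact := sFact_add q (2 * l - y) y
    rw [Nat.sub_add_cancel hyl] at hfact
    push_cast at hfact
    have hpow : (2 : K) ^ (2 * l) = 2 ^ (2 * l - y) * 2 ^ y := by
      rw [← pow_add, Nat.sub_add_cancel hyl]
    have hn1 := sFact_ne_zero hs (2 * l)
    have hn2 := sFact_ne_zero hs (2 * l - y)
    have hn3 := sFactTwo_ne_zero hs (X + m - l)
    rw [hfact] at hn1
    have hn4 := right_ne_zero_of_mul hn1
    rw [startWeight, hsplit, hfact, hpow]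
    have key : (∏ t ∈ Finset.range (2 * l - y),
          sDiff q (2 * (((X + 1 + l : ℕ) : ℤ) - (2 * l - y : ℕ) + t + 1))) * sFactTwo q (X + m - l) =
        sFactTwo q (X + 1 + l) *
          ∏ v ∈ Finset.range (m - 1 - y), sDiff q (2 * (X + 2 + (y + v) - l)) := by
      by_cases hR : l ≤ X + 1 + y
      · have e1 := sFactTwo_add q (X + 1 + y - l) (2 * l - y)
        have e2 := sFactTwo_add q (X + 1 + y - l) (m - 1 - y)
        rw [show X + 1 + y - l + (2 * l - y) = X + 1 + l by omega] at e1
        rw [show X + 1 + y - l + (m - 1 - y) = X + m - l by omega] at e2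
        have e3 : ∀ t : ℕ, 2 * (((X + 1 + l : ℕ) : ℤ) - (2 * l - y : ℕ) + t + 1) =
            2 * ((X + 1 + y - l : ℕ) + t + 1) := by
          intro t
          omega
        have e4 : ∀ t : ℕ, 2 * ((X : ℤ) + 2 + (y + t) - l) =
            2 * ((X + 1 + y - l : ℕ) + t + 1) := by
          intro t
          omega
        simp only [e3, e4]
        rw [e1, e2]
        ring
      -- Here both products contain the factor `sDiff q 0`.
      · rw [Finset.prod_eq_zero (i := l - y - X - 2) (by simp; omega),
          Finset.prod_eq_zero (s := Finset.range (m - 1 - y)) (i := l - X - 2 - y)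
            (by simp; omega)]
        · simp
        · convert sDiff_zero q using 2
          omega
        · convert sDiff_zero q using 2
          omega
    rw [div_mul_eq_mul_div, div_mul_eq_mul_div, div_eq_div_iff]
    · linear_combination (2 ^ (2 * l - y) * 2 ^ y * sFact q (2 * l - y) *
        ∏ u ∈ Finset.range y, sDiff q (2 * l - u)) * key
    · exact mul_ne_zero (pow_ne_zero _ h2) hn2
    · refine mul_ne_zero (mul_ne_zero hn3 hn1) (mul_ne_zero ?_ ?_) <;> exact pow_ne_zero _ h2
  -- A path cannot rise, so the weight is zero for `y > 2l`; on the right the factor at `u = 2l`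
  -- vanishes.
  · rw [Finset.prod_eq_zero (i := 2 * l) (by simp; omega), mul_zero]
    rw [if_pos (by omega)]
    push_cast
    rw [sub_self, sDiff_zero]

end ClosedForm

/-! ### A determinant of products of symmetric differences -/

section Determinant

variable {K : Type*} [Field K]

theorem exists_coeff_prod_linear (α β : ℕ → K) (n : ℕ) : ∃ c : ℕ → K, ∀ v w : K,
    ∏ u ∈ Finset.range n, (α u * v + β u * w) =
      ∑ j ∈ Finset.range (n + 1), v ^ j * w ^ (n - j) * c j := by
  induction n with
  | zero => exact ⟨fun _ => 1, by simp⟩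
  | succ n ih =>
    obtain ⟨c, hc⟩ := ih
    refine ⟨fun j => (if j = 0 then 0 else α n * c (j - 1)) + if j ≤ n then β n * c j else 0,
      fun v w => ?_⟩
    rw [Finset.prod_range_succ, hc, mul_add]
    simp only [mul_add, Finset.sum_add_distrib]
    congr 1
    · rw [Finset.sum_range_succ' _ (n + 1)]
      simp only [Nat.add_sub_cancel, Nat.add_eq_zero_iff, one_ne_zero, and_false, if_false, if_true,
        mul_zero, add_zero, Nat.add_sub_add_right, Finset.sum_mul]
      exact Finset.sum_congr rfl fun j _ => by ring
    · rw [Finset.sum_range_succ _ (n + 1), if_neg (by omega), mul_zero, add_zero, Finset.sum_mul]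
      refine Finset.sum_congr rfl fun j hj => ?_
      have hj' := Finset.mem_range.1 hj
      rw [if_pos (by omega), show n + 1 - j = (n - j) + 1 by omega]
      ring

theorem sDiff_sub {q : K} (hq : q ≠ 0) (a b : ℤ) :
    sDiff q (a - b) = q ^ a * q ^ (-b) - q ^ b * q ^ (-a) := by
  rw [sDiff, neg_sub, sub_eq_add_neg a, sub_eq_add_neg b, zpow_add₀ hq, zpow_add₀ hq]

/-- Each entry is a form of degree `m - 1` in `q ^ L k` and `q ^ (-L k)` whose coefficients depend
only on the column. The matrix is thus a projective Vandermonde matrix times a matrix independent of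
`L`, whose determinant can be read off at one convenient choice of `L`. -/
theorem det_prod_sDiff {q : K} (hq : q ≠ 0) (hs : ∀ n : ℕ, sDiff q (n + 1) ≠ 0) {m : ℕ}
    (A : ℕ → ℤ) (L : Fin m → ℤ) :
    (Matrix.of fun k y : Fin m => ∏ u ∈ Finset.range (m - 1),
      if u < (y : ℕ) then sDiff q (L k - u) else sDiff q (A u - L k)).det =
    (∏ j : Fin m, ∏ i ∈ Finset.univ.filter (· < j), sDiff q (L j - L i)) *
      ∏ k : Fin m, ∏ u ∈ Finset.range (m - 1),
        if u < (k : ℕ) then 1 else sDiff q (A u - (k : ℕ)) := by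
  have hC : ∀ y : Fin m, ∃ c : ℕ → K, ∀ z : ℤ, (∏ u ∈ Finset.range (m - 1),
      if u < (y : ℕ) then sDiff q (z - u) else sDiff q (A u - z)) =
      ∑ j ∈ Finset.range m, (q ^ z) ^ j * (q ^ (-z)) ^ (m - 1 - j) * c j := by
    intro y
    obtain ⟨c, hc⟩ := exists_coeff_prod_linear
      (fun u => if u < (y : ℕ) then q ^ (-(u : ℤ)) else -q ^ (-A u))
      (fun u => if u < (y : ℕ) then -q ^ (u : ℤ) else q ^ (A u)) (m - 1)
    refine ⟨c, fun z => ?_⟩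
    have hm : m - 1 + 1 = m := by have := y.2; omega
    rw [hm] at hc
    rw [← hc]
    refine Finset.prod_congr rfl fun u _ => ?_
    rw [sDiff_sub hq, sDiff_sub hq]
    split_ifs <;> ring
  choose c hc using hC
  have hmat : ∀ z : Fin m → ℤ, (Matrix.of fun k y : Fin m => ∏ u ∈ Finset.range (m - 1),
      if u < (y : ℕ) then sDiff q (z k - u) else sDiff q (A u - z k)).det =
      (∏ j : Fin m, ∏ i ∈ Finset.univ.filter (· < j), sDiff q (z j - z i)) *
        (Matrix.of fun j y : Fin m => c y j).det := by
    intro z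
    have h1 : (Matrix.of fun k y : Fin m => ∏ u ∈ Finset.range (m - 1),
        if u < (y : ℕ) then sDiff q (z k - u) else sDiff q (A u - z k)) =
        Matrix.projVandermonde (fun k => q ^ z k) (fun k => q ^ (-z k)) *
          Matrix.of fun j y : Fin m => c y j := by
      ext k y
      rw [Matrix.of_apply, hc, Matrix.mul_apply, Finset.sum_range]
      refine Finset.sum_congr rfl fun j _ => ?_
      rw [Matrix.projVandermonde_apply, Matrix.of_apply, Fin.val_rev, Nat.sub_sub, add_comm 1]
    rw [h1, Matrix.det_mul, Matrix.det_projVandermonde]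
    congr 1
    simp only [← sDiff_sub hq]
    exact Finset.prod_comm' (by simp)
  -- At `L k = k` the matrix is lower triangular, since the factor `u = k` vanishes in every column
  -- `y > k`; the Vandermonde part of the diagonal product is nonzero and cancels.
  have hB := hmat fun k => ((k : ℕ) : ℤ)
  rw [Matrix.det_of_isLowerTriangular] at hB
  · have hdiag : ∀ k : Fin m, (∏ u ∈ Finset.range (m - 1),
        if u < (k : ℕ) then sDiff q ((k : ℕ) - u : ℤ) else sDiff q (A u - (k : ℕ))) =
        (∏ i ∈ Finset.univ.filter (· < k), sDiff q ((k : ℕ) - (i : ℕ) : ℤ)) *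
        ∏ u ∈ Finset.range (m - 1), if u < (k : ℕ) then 1 else sDiff q (A u - (k : ℕ)) := by
      intro k
      have : (∏ i ∈ Finset.univ.filter (· < k), sDiff q ((k : ℕ) - (i : ℕ) : ℤ)) =
          ∏ u ∈ Finset.range (m - 1), if u < (k : ℕ) then sDiff q ((k : ℕ) - u : ℤ) else 1 := by
        rw [← Finset.prod_filter]
        refine Finset.prod_bij (fun i _ => (i : ℕ)) ?_ ?_ ?_ ?_
        · intro i hi
          have h1 := (Finset.mem_filter.1 hi).2
          have h2 := k.2
          rw [Fin.lt_def] at h1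
          simp only [Finset.mem_filter, Finset.mem_range]
          omega
        · exact fun i _ j _ h => Fin.ext h
        · intro u hu
          have h1 := (Finset.mem_filter.1 hu).2
          exact ⟨⟨u, h1.trans k.2⟩, Finset.mem_filter.2 ⟨Finset.mem_univ _, Fin.lt_def.2 h1⟩, rfl⟩
        · exact fun _ _ => rfl
      rw [this, ← Finset.prod_mul_distrib]
      exact Finset.prod_congr rfl fun u _ => by split_ifs <;> simp
    simp only [Matrix.of_apply, hdiag, Finset.prod_mul_distrib] at hB
    rw [hmat L, mul_left_cancel₀ ?_ hB]
    refine Finset.prod_ne_zero_iff.2 fun j _ => Finset.prod_ne_zero_iff.2 fun i hi => ?_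
    have h1 := (Finset.mem_filter.1 hi).2
    rw [Fin.lt_def] at h1
    have := hs (j - i - 1)
    convert this using 2
    omega
  · intro k y hky
    have h1 : (k : ℕ) < y := hky
    have h2 := y.2
    rw [Matrix.of_apply]
    refine Finset.prod_eq_zero (i := (k : ℕ)) (by simp; omega) ?_
    rw [if_pos h1, sub_self, sDiff_zero]

end Determinant

/-! ### The region of type B as a starting frontier -/

section RegionB

variable {K : Type*} [Field K]

/-- The finite set of all points that satisfy `InBounds`. -/
noncomputable def boundedPoints (X : ℤ) (d m : ℕ) : Finset (ℤ × ℤ) :=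
  open scoped Classical in
  (Finset.Icc (-(d : ℤ) - 1) X ×ˢ Finset.Icc (0 : ℤ) (2 * d)).filter (InBounds X d m)

theorem mem_boundedPoints {X : ℤ} {d m : ℕ} {p : ℤ × ℤ} :
    p ∈ boundedPoints X d m ↔ InBounds X d m p := by
  simp only [boundedPoints, Finset.mem_filter, Finset.mem_product, Finset.mem_Icc,
    and_iff_right_iff_imp]
  rintro ⟨h1, h2, h3, h4, h5⟩
  omega

/-- The last conjunct reflects the bottom-most west step of length `2`: there is no bump at height
`0`. -/
theorem upTri_mem_fullRegion {x d m X : ℕ} (hX : X + m = x + d) {p : ℤ × ℤ} :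
    upTri p ∈ fullRegion x d m ↔ 0 ≤ p.2 ∧ p.2 ≤ 2 * d ∧ 0 ≤ 2 * p.1 + p.2 ∧
      p.1 + p.2 ≤ X + m ∧ p.1 ≤ X ∧ (p.2 = 0 → 1 ≤ p.1) := by
  obtain ⟨a, j⟩ := p
  have hodd : Odd (2 * a + 1 + j + j) := ⟨a + j, by ring⟩
  have h0 : ∀ z : ℤ, west z = if z = 0 then 2 else if z % 2 = 0 then 0 else 1 := by
    intro z
    simp only [west, Int.even_iff]
  simp only [mem_fullRegion, upTri, verts, hodd, if_true, Finset.forall_mem_insert,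
    Finset.mem_singleton, forall_eq, east, le_min_iff, h0]
  split_ifs <;> omega

theorem downTri_mem_fullRegion {x d m X : ℕ} (hX : X + m = x + d) {p : ℤ × ℤ} :
    downTri p ∈ fullRegion x d m ↔ InBounds X d m p := by
  obtain ⟨a, j⟩ := p
  have hodd : ¬ Odd (2 * a + 2 + j + j) := by
    rw [Int.not_odd_iff_even]
    exact ⟨a + 1 + j, by ring⟩
  have h0 : ∀ z : ℤ, west z = if z = 0 then 2 else if z % 2 = 0 then 0 else 1 := by
    intro z
    simp only [west, Int.even_iff]
  simp only [mem_fullRegion, downTri, verts, hodd, if_false, Finset.forall_mem_insert,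
    Finset.mem_singleton, forall_eq, east, le_min_iff, h0, InBounds]
  split_ifs <;> omega

/-- The only up-pointing triangles of the full region without a left neighbour in it are those in
the bumps, on `2 * p.1 + p.2 = 0`. The dents remove all of these except the `m` path starts. -/
theorem regionB_eq_pathRegion {x d m X : ℕ} (hX : X + m = x + d) {l : Fin m → ℕ}
    (hl : ∀ i, 1 ≤ l i ∧ l i ≤ d) :
    regionB x d l = pathRegion X (Finset.univ.image fun k => (-(l k : ℤ), 2 * (l k : ℤ)))
      (boundedPoints X d m) := by
  refine finset_tri_ext (fun p => ?_) (fun p => ?_)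
  · obtain ⟨a, j⟩ := p
    rw [regionB, Finset.mem_sdiff, upTri_mem_fullRegion hX, upTri_mem_pathRegion,
      mem_boundedPoints]
    have hd : upTri (a, j) ∈ dents d l ↔
        2 * a + j = 0 ∧ 2 ≤ j ∧ j ≤ 2 * d ∧ ¬ ∃ k, 2 * (l k : ℤ) = j := by
      simp only [dents, Finset.mem_image, Finset.mem_sdiff, Finset.mem_Icc, Finset.mem_univ,
        true_and, upTri, Prod.mk.injEq]
      constructor
      · rintro ⟨k, ⟨hk, hkl⟩, h1, h2⟩
        refine ⟨by omega, by omega, by omega, ?_⟩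
        rintro ⟨i, hi⟩
        exact hkl ⟨i, by omega⟩
      · rintro ⟨h1, h2, h3, h4⟩
        refine ⟨j.toNat / 2, ⟨by omega, ?_⟩, by omega, by omega⟩
        rintro ⟨i, hi⟩
        exact h4 ⟨i, by omega⟩
    have hA : (a, j) ∈ Finset.univ.image (fun k => (-(l k : ℤ), 2 * (l k : ℤ))) ↔
        2 * a + j = 0 ∧ ∃ k, 2 * (l k : ℤ) = j := by
      simp only [Finset.mem_image, Finset.mem_univ, true_and, Prod.mk.injEq]
      constructor
      · rintro ⟨k, h1, h2⟩
        exact ⟨by omega, k, h2⟩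
      · rintro ⟨h1, k, h2⟩
        exact ⟨k, by omega, h2⟩
    rw [hd, hA]
    simp only [InBounds]
    have hE : (∃ k, 2 * (l k : ℤ) = j) → 2 ≤ j ∧ j ≤ 2 * d := by
      rintro ⟨k, hk⟩
      have := hl k
      omega
    by_cases hex : ∃ k, 2 * (l k : ℤ) = j
    · have := hE hex
      simp only [hex, not_true_eq_false, and_false, not_false_eq_true, and_true]
      omega
    · simp only [hex, not_false_eq_true, and_true, and_false, false_or]
      omega
  · rw [regionB, Finset.mem_sdiff, downTri_mem_fullRegion hX, downTri_mem_pathRegion,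
      mem_boundedPoints, and_iff_left_iff_imp]
    intro _ h
    simp only [dents, Finset.mem_image, downTri, Prod.mk.injEq] at h
    obtain ⟨k, -, h1, h2⟩ := h
    omega

theorem isFrontier_start {x d m X : ℕ} (hX : X + m = x + d) {l : Fin m → ℕ}
    (hmono : StrictMono l) (hl : ∀ i, 1 ≤ l i ∧ l i ≤ d) :
    IsFrontier X d (fun k => (-(l k : ℤ), 2 * (l k : ℤ))) (boundedPoints X d m) := by
  refine ⟨fun e he => mem_boundedPoints.1 he, ?_, ?_, ?_, ?_, ?_⟩
  · intro i j hij
    have := hmono.monotone hij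
    simp only
    omega
  · intro i j hij
    have := hmono hij
    simp only
    omega
  · intro k
    have := hl k
    simp only
    omega
  · intro k
    rw [mem_boundedPoints]
    rintro ⟨-, -, h, -, -⟩
    simp only at h
    omega
  · intro e he he'
    exact absurd (mem_boundedPoints.2 he) he'

/-- The tiling generating function of the region of type B as a determinant of path weights. -/
theorem tilingGF_regionB_eq_det (q : K) {x d m X : ℕ} (hX : X + m = x + d)
    {l : Fin m → ℕ} (hmono : StrictMono l) (hl : ∀ i, 1 ≤ l i ∧ l i ≤ d) :
    tilingGF q (regionB x d l) =
      (Matrix.of fun k y : Fin m => pathWeight q X (-(l k : ℤ), 2 * (l k : ℤ)) (y : ℕ)).det := by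
  rw [regionB_eq_pathRegion hX hl, (isFrontier_start hX hmono hl).tilingGF_eq_det]

/-- The tiling generating function of the region of type B as a product. -/
theorem tilingGF_regionB_eq_prod {q : K} (hq : q ≠ 0) (h2 : (2 : K) ≠ 0)
    (hs : ∀ n : ℕ, sDiff q (n + 1) ≠ 0) {x d m X : ℕ} (hX : X + m = x + d)
    {l : Fin m → ℕ} (hmono : StrictMono l) (hl : ∀ i, 1 ≤ l i ∧ l i ≤ d) :
    tilingGF q (regionB x d l) =
      (∏ k : Fin m, sFactTwo q (X + 1 + l k) /
        (sFactTwo q (X + m - l k) * sFact q (2 * l k) * 2 ^ (2 * l k))) *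
      (∏ k : Fin m, (2 : K) ^ (k : ℕ)) *
      ((∏ j : Fin m, ∏ i ∈ Finset.univ.filter (· < j),
          sDiff q (2 * (l j : ℤ) - 2 * (l i : ℤ))) *
        ∏ k : Fin m, ∏ u ∈ Finset.range (m - 1),
          if u < (k : ℕ) then 1 else sDiff q (2 * (X + 2 + u) - (k : ℕ))) := by
  have hmat : (Matrix.of fun k y : Fin m =>
      pathWeight q X (-(l k : ℤ), 2 * (l k : ℤ)) (y : ℕ)) =
      Matrix.of fun k y : Fin m => sFactTwo q (X + 1 + l k) /
        (sFactTwo q (X + m - l k) * sFact q (2 * l k) * 2 ^ (2 * l k)) *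
        (Matrix.of fun k y : Fin m => (2 : K) ^ (y : ℕ) *
          (Matrix.of fun k y : Fin m => ∏ u ∈ Finset.range (m - 1),
            if u < (y : ℕ) then sDiff q (2 * (l k : ℤ) - u)
            else sDiff q (2 * (X + 2 + u) - 2 * (l k : ℤ))) k y) k y := by
    ext k y
    have := hl k
    simp only [Matrix.of_apply]
    rw [pathWeight_start_eq_mul hq h2 hs (by omega) y.2, mul_assoc]
  rw [tilingGF_regionB_eq_det q hX hmono hl, hmat, Matrix.det_mul_column, Matrix.det_mul_row,
    det_prod_sDiff hq hs (fun u => 2 * (X + 2 + u)) fun k => 2 * (l k : ℤ), mul_assoc]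

end RegionB

/-! ### Comparison with the product formula -/

section ProductFormula

variable {K : Type*} [Field K]

theorem zpow_sum {ι : Type*} {q : K} (hq : q ≠ 0) (s : Finset ι) (f : ι → ℤ) :
    q ^ ∑ i ∈ s, f i = ∏ i ∈ s, q ^ f i := by
  classical
  induction s using Finset.induction_on with
  | empty => simp
  | insert a s ha ih => rw [Finset.sum_insert ha, Finset.prod_insert ha, zpow_add₀ hq, ih]

theorem prod_Icc_one_eq_prod_range {M : Type*} [CommMonoid M] (f : ℤ → M) (n : ℕ) :
    ∏ j ∈ Finset.Icc (1 : ℤ) n, f j = ∏ t ∈ Finset.range n, f (t + 1) := by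
  symm
  refine Finset.prod_bij (fun t _ => (t : ℤ) + 1) ?_ ?_ ?_ ?_
  · intro t ht
    have := Finset.mem_range.1 ht
    simp only [Finset.mem_Icc]
    omega
  · intro t _ t' _ h
    omega
  · intro j hj
    have := Finset.mem_Icc.1 hj
    exact ⟨(j - 1).toNat, by simp only [Finset.mem_range]; omega, by omega⟩
  · exact fun _ _ => rfl

/-- Every `q`-integer contributes a power of `q`, one copy of a constant, and a symmetric
difference; the three are tracked separately. -/
theorem qInt_sq_eq {q : K} (hq : q ≠ 0) (h1 : sDiff q 1 ≠ 0) {n : ℤ} (hn : 0 ≤ n) :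
    qInt (q ^ 2) n = q ^ n * (q * sDiff q 1)⁻¹ * sDiff q n := by
  obtain ⟨n, rfl⟩ := Int.eq_ofNat_of_zero_le hn
  have h2 : q * sDiff q 1 = q ^ 2 - 1 := by
    simp only [sDiff, zpow_neg, zpow_one]
    field_simp
  have h3 : q ^ (n : ℤ) * sDiff q n = (q ^ 2) ^ n - 1 := by
    have : q ^ n ≠ 0 := pow_ne_zero _ hq
    simp only [sDiff, zpow_neg, zpow_natCast]
    field_simp
    ring
  have h4 : q ^ 2 - 1 ≠ 0 := h2 ▸ mul_ne_zero hq h1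
  rw [mul_right_comm, h3, h2, ← div_eq_mul_inv, eq_div_iff h4, qInt, Int.toNat_natCast,
    geom_sum_mul]

theorem prod_qInt_sq {ι : Type*} {q : K} (hq : q ≠ 0) (h1 : sDiff q 1 ≠ 0) (s : Finset ι)
    (f : ι → ℤ) (hf : ∀ i ∈ s, 0 ≤ f i) :
    ∏ i ∈ s, qInt (q ^ 2) (f i) =
      q ^ (∑ i ∈ s, f i) * (q * sDiff q 1)⁻¹ ^ s.card * ∏ i ∈ s, sDiff q (f i) := by
  rw [Finset.prod_congr rfl fun i hi => qInt_sq_eq hq h1 (hf i hi), Finset.prod_mul_distrib,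
    Finset.prod_mul_distrib, zpow_sum hq, Finset.prod_const]

/-- The term `f j` occurs `j` times with a plus sign and `m - 1 - j` times with a minus sign. -/
theorem sum_sub_of_lt {m : ℕ} (f : Fin m → ℤ) :
    ∑ j : Fin m, ∑ i ∈ Finset.univ.filter (· < j), (f j - f i) =
      ∑ j : Fin m, (2 * (j : ℕ) - (m - 1)) * f j := by
  have h1 : ∑ j : Fin m, ∑ i ∈ Finset.univ.filter (· < j), f i =
      ∑ i : Fin m, ∑ j ∈ Finset.Ioi i, f i := Finset.sum_comm' (by simp)
  simp only [Finset.sum_sub_distrib, h1, Finset.sum_const, Fin.card_Ioi, nsmul_eq_mul]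
  rw [← Finset.sum_sub_distrib]
  refine Finset.sum_congr rfl fun j _ => ?_
  have h2 : Finset.univ.filter (· < j) = Finset.Iio j := by
    ext i
    simp
  have h3 : ((m - 1 - (j : ℕ) : ℕ) : ℤ) = m - 1 - (j : ℕ) := by
    have := j.2
    omega
  rw [h2, Fin.card_Iio, h3]
  ring

theorem two_mul_sum_range_add (n : ℕ) (a : ℤ) :
    2 * ∑ t ∈ Finset.range n, (a + t) = n * (2 * a + n - 1) := by
  induction n with
  | zero => simp
  | succ n ih =>
    rw [Finset.sum_range_succ, mul_add, ih]
    push_cast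
    ring

theorem two_mul_bracketSum {a b : ℤ} (h : a ≤ b + 1) :
    2 * bracketSum b a = (b - a + 1) * (a + b) := by
  have h1 : bracketSum b a = ∑ t ∈ Finset.range (b + 1 - a).toNat, (a + t) := by
    symm
    refine Finset.sum_bij (fun t _ => a + (t : ℤ)) ?_ ?_ ?_ ?_
    · intro t ht
      have := Finset.mem_range.1 ht
      simp only [Finset.mem_Icc]
      omega
    · intro t _ t' _ h
      omega
    · intro j hj
      have := Finset.mem_Icc.1 hj
      exact ⟨(j - a).toNat, by simp only [Finset.mem_range]; omega, by omega⟩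
    · exact fun _ _ => rfl
  rw [h1, two_mul_sum_range_add, Int.toNat_of_nonneg (by omega)]
  ring

/-- This is the termwise discrepancy between the two doubled exponents in `sum_qExponent`, which
agree only after summation over `k`. -/
theorem sum_fin_quadratic (m : ℕ) :
    ∑ k : Fin m, (6 * ((k : ℕ) + 1 : ℤ) ^ 2 - 4 * m * ((k : ℕ) + 1 : ℤ) - (m + 1)) = 0 := by
  rw [Fin.sum_univ_eq_sum_range
    (fun k : ℕ => (6 * ((k : ℤ) + 1) ^ 2 - 4 * m * ((k : ℤ) + 1) - ((m : ℤ) + 1)))]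
  have h : ∀ n : ℕ, ∑ k ∈ Finset.range n,
      (6 * ((k : ℤ) + 1) ^ 2 - 4 * m * ((k : ℤ) + 1) - ((m : ℤ) + 1)) =
      n * (n + 1) * (2 * n + 1) - 2 * m * (n * (n + 1)) - n * ((m : ℤ) + 1) := by
    intro n
    induction n with
    | zero => simp
    | succ n ih =>
      rw [Finset.sum_range_succ, ih]
      push_cast
      ring
  rw [h]
  ring

/-- The exponent of `q` that the `k`-th factor of the product formula contributes. -/
def qExponent (X m : ℕ) (l : Fin m → ℕ) (k : Fin m) : ℤ :=
  ∑ i ∈ Finset.univ.filter (· < k), 2 * ((l k : ℤ) - l i) +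
    (2 * (X + (k : ℕ) + 1) + 2 * (X + (k : ℕ) + 2)) +
    ∑ t ∈ Finset.range k, (2 * X + (k : ℕ) + 3 + t : ℤ) +
    (∑ t ∈ Finset.range (l k - (k + 1)), 2 * ((X : ℤ) + (k : ℕ) + t + 3) +
      ∑ t ∈ Finset.range (l k - (k + 1)), 2 * ((X : ℤ) + m - (k : ℕ) - t - 1)) -
    ∑ t ∈ Finset.range (2 * l k), (1 + t : ℤ)

theorem two_mul_qExponent {X m : ℕ} {l : Fin m → ℕ} {k : Fin m} (hk : (k : ℕ) + 1 ≤ l k) :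
    2 * qExponent X m l k = 4 * ∑ i ∈ Finset.univ.filter (· < k), ((l k : ℤ) - l i) +
      (4 * (2 * X + 2 * (k : ℕ) + 3) + (k : ℕ) * (2 * (2 * X + (k : ℕ) + 3) + (k : ℕ) - 1) +
      2 * (l k - (k + 1)) * (4 * X + 2 * m + 4) - 2 * l k * (2 * l k + 1)) := by
  have h1 := two_mul_sum_range_add k (2 * X + (k : ℕ) + 3)
  have h2 := two_mul_sum_range_add (2 * l k) 1
  rw [qExponent, ← Finset.mul_sum, ← Finset.sum_add_distrib]
  have h3 : ∑ t ∈ Finset.range (l k - (k + 1)), (2 * ((X : ℤ) + (k : ℕ) + t + 3) +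
      2 * ((X : ℤ) + m - (k : ℕ) - t - 1)) = (l k - (k + 1)) * (4 * X + 2 * m + 4) := by
    rw [Finset.sum_congr rfl fun (t : ℕ) _ => (by ring : 2 * ((X : ℤ) + (k : ℕ) + t + 3) +
      2 * ((X : ℤ) + m - (k : ℕ) - t - 1) = 4 * X + 2 * m + 4), Finset.sum_const,
      Finset.card_range, nsmul_eq_mul]
    push_cast [Nat.cast_sub hk]
    ring
  rw [h3]
  push_cast at h2
  linear_combination h1 - h2

theorem ePrime_zero {d m : ℕ} (hmd : m ≤ d) : ePrime 0 d m 0 = 0 := by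
  simp only [ePrime]
  omega

theorem xTilde_zero {x d m X : ℕ} (hX : X + m = x + d) (hmd : m ≤ d) :
    xTilde x 0 d m 0 = X := by
  rw [xTilde, ePrime_zero hmd]
  omega

theorem sum_qExponent {x d m X : ℕ} (hX : X + m = x + d) (hmd : m ≤ d) {l : Fin m → ℕ}
    (hk : ∀ k : Fin m, (k : ℕ) + 1 ≤ l k) :
    ∑ k, qExponent X m l k = EPrime x 0 d l ![] := by
  have hX' : (X : ℤ) = x + d - m := by omega
  have hf : 2 * fExp (2 * ((x : ℤ) + (0 : ℕ) - (0 : ℕ) - 0) + 1 + 2 * d - m) ((0 : ℕ) + 1) m =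
      ∑ k : Fin m, (4 * X + m + 3 : ℤ) := by
    rw [fExp, Int.mul_ediv_cancel']
    · simp only [Finset.sum_const, Finset.card_univ, Fintype.card_fin, nsmul_eq_mul]
      push_cast
      rw [hX']
      ring
    · push_cast
      -- The numerator in `fExp` is `4m(x + d) - 3m(m - 1)`, so the integer division by `2` is
      -- exact.
      obtain ⟨c, hc⟩ : (2 : ℤ) ∣ m * (m - 1) := (Int.even_mul_pred_self (m : ℤ)).two_dvd
      exact ⟨m * (2 * x + 2 * d) - 3 * c, by linear_combination (-3) * hc⟩
  have hb : ∀ k : Fin m, 2 * bracketSum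
      (2 * ((x : ℤ) + (0 : ℕ) - (0 : ℕ) - 0) + 1 + 2 * d - m - (m - idx k + 1))
      (2 * ((x : ℤ) + (0 : ℕ) - (0 : ℕ) - 0) + 1 + 2 * (d - l k) - 2 * (m - idx k)) =
      (2 * l k - (k + 1)) * (4 * X + 1 + 3 * (k + 1) - 2 * l k) := by
    intro k
    have := hk k
    rw [two_mul_bracketSum]
    · rw [hX', idx]
      push_cast
      ring
    · simp only [idx]
      push_cast
      omega
  have h2 : 2 * ∑ k, qExponent X m l k = 2 * EPrime x 0 d l ![] := by
    rw [EPrime, ePrime_zero hmd]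
    simp only [Finset.univ_eq_empty, Finset.sum_empty, add_zero]
    rw [mul_add, hf, Finset.mul_sum, Finset.mul_sum, Finset.sum_congr rfl fun k _ => hb k,
      ← Finset.sum_add_distrib, Finset.sum_congr rfl fun k _ => two_mul_qExponent (hk k),
      Finset.sum_add_distrib, ← Finset.mul_sum, sum_sub_of_lt, Finset.mul_sum,
      ← Finset.sum_add_distrib, ← sub_eq_zero, ← Finset.sum_sub_distrib, ← sum_fin_quadratic m]
    refine Finset.sum_congr rfl fun k _ => ?_
    ring
  omega

/-- The `k`-th factor of the product formula, in terms of symmetric differences. -/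
noncomputable def symFactor (q : K) (X m : ℕ) (l : Fin m → ℕ) (k : Fin m) : K :=
  (∏ i ∈ Finset.univ.filter (· < k), sDiff q (2 * ((l k : ℤ) - l i))) *
    (sDiff q (2 * (X + (k : ℕ) + 1)) * sDiff q (2 * (X + (k : ℕ) + 2))) *
    (∏ t ∈ Finset.range k, sDiff q (2 * X + (k : ℕ) + 3 + t)) *
    ((∏ t ∈ Finset.range (l k - (k + 1)), sDiff q (2 * ((X : ℤ) + (k : ℕ) + t + 3))) *
      ∏ t ∈ Finset.range (l k - (k + 1)), sDiff q (2 * ((X : ℤ) + m - (k : ℕ) - t - 1))) /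
    ∏ t ∈ Finset.range (2 * l k), sDiff q (1 + t)

theorem prod_qInt_eq_symFactor {q : K} (hq : q ≠ 0) (hs : ∀ n : ℕ, sDiff q (n + 1) ≠ 0)
    {d m X : ℕ} (hX : d ≤ X + m) {l : Fin m → ℕ} (hmono : StrictMono l)
    (hl : ∀ k : Fin m, (k : ℕ) + 1 ≤ l k ∧ l k ≤ d) (k : Fin m) :
    (∏ i ∈ Finset.univ.filter (· < k), qInt (q ^ 2) (2 * ((l k : ℤ) - l i))) *
      (qInt (q ^ 2) (2 * (X + (k : ℕ) + 1)) * qInt (q ^ 2) (2 * (X + (k : ℕ) + 2))) *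
      (∏ t ∈ Finset.range k, qInt (q ^ 2) (2 * X + (k : ℕ) + 3 + t)) *
      ((∏ t ∈ Finset.range (l k - (k + 1)), qInt (q ^ 2) (2 * ((X : ℤ) + (k : ℕ) + t + 3))) *
        ∏ t ∈ Finset.range (l k - (k + 1)),
          qInt (q ^ 2) (2 * ((X : ℤ) + m - (k : ℕ) - t - 1))) /
      (∏ t ∈ Finset.range (2 * l k), qInt (q ^ 2) (1 + t)) =
    q ^ qExponent X m l k * symFactor q X m l k := by
  have h1 : sDiff q 1 ≠ 0 := by simpa using hs 0
  have hc : (q * sDiff q 1)⁻¹ ≠ 0 := inv_ne_zero (mul_ne_zero hq h1)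
  have hlk := hl k
  have hcard : (Finset.univ.filter (· < k)).card = k := by
    rw [← Fin.card_Iio k]
    congr 1
    ext i
    simp
  -- The numerator has `k + 2 + k + 2(l k - k - 1) = 2 l k` factors, as many as the `q`-factorial
  -- below, so the constants cancel.
  have hpow : (q * sDiff q 1)⁻¹ ^ (2 * l k) = (q * sDiff q 1)⁻¹ ^ (k : ℕ) *
      ((q * sDiff q 1)⁻¹ * (q * sDiff q 1)⁻¹) * (q * sDiff q 1)⁻¹ ^ (k : ℕ) *
      ((q * sDiff q 1)⁻¹ ^ (l k - (k + 1)) * (q * sDiff q 1)⁻¹ ^ (l k - (k + 1))) := by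
    rw [← pow_two, ← pow_add, ← pow_add, ← pow_add, ← pow_add]
    congr 1
    omega
  have hprod : ∏ t ∈ Finset.range (2 * l k), sDiff q (1 + t) ≠ 0 :=
    Finset.prod_ne_zero_iff.2 fun t _ => add_comm (t : ℤ) 1 ▸ hs t
  rw [prod_qInt_sq hq h1 _ _ fun i hi => ?_, qInt_sq_eq hq h1 (by positivity),
    qInt_sq_eq hq h1 (by positivity), prod_qInt_sq hq h1 _ _ fun t _ => by positivity,
    prod_qInt_sq hq h1 _ _ fun t _ => by positivity, prod_qInt_sq hq h1 _ _ fun t ht => ?_,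
    prod_qInt_sq hq h1 _ _ fun t _ => by positivity, hcard, Finset.card_range, Finset.card_range,
    Finset.card_range, hpow, qExponent, zpow_sub₀ hq, zpow_add₀ hq, zpow_add₀ hq, zpow_add₀ hq,
    zpow_add₀ hq, zpow_add₀ hq, symFactor]
  · generalize (q * sDiff q 1)⁻¹ = c at *
    have hz : q ^ ∑ t ∈ Finset.range (2 * l k), (1 + t : ℤ) ≠ 0 := zpow_ne_zero _ hq
    have hc1 : c ^ (k : ℕ) ≠ 0 := pow_ne_zero _ hc
    have hc2 : c ^ (l k - (k + 1)) ≠ 0 := pow_ne_zero _ hc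
    field_simp
  · have := Finset.mem_range.1 ht
    omega
  · have := hmono (Finset.mem_filter.1 hi).2
    omega

theorem Q_eq_prod_symFactor {q : K} (hq : q ≠ 0) (hs : ∀ n : ℕ, sDiff q (n + 1) ≠ 0)
    {x d m X : ℕ} (hX : X + m = x + d) (hmd : m ≤ d) {l : Fin m → ℕ} (hmono : StrictMono l)
    (hl : ∀ k : Fin m, (k : ℕ) + 1 ≤ l k ∧ l k ≤ d) :
    Q q x 0 d l ![] = 2 ^ (-FPrime l ![]) * ∏ k, symFactor q X m l k := by
  rw [Q, xTilde_zero hX hmd, ← sum_qExponent hX hmd fun k => (hl k).1]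
  have hfact : ∀ k, qFact (q ^ 2) (2 * (l k : ℤ)) =
      ∏ t ∈ Finset.range (2 * l k), qInt (q ^ 2) (1 + t) := by
    intro k
    have := prod_Icc_one_eq_prod_range (qInt (q ^ 2)) (2 * l k)
    simp only [add_comm _ (1 : ℤ)] at this
    push_cast at this
    exact this
  have hIcc1 : ∀ k : Fin m, ∏ j ∈ Finset.Icc (1 : ℤ) ((0 : ℕ) + idx k - 1),
      qInt (q ^ 2) (2 * (X : ℤ) + (0 : ℕ) + idx k + j + 1) =
      ∏ t ∈ Finset.range k, qInt (q ^ 2) (2 * X + (k : ℕ) + 3 + t) := by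
    intro k
    rw [show ((0 : ℕ) + idx k - 1 : ℤ) = (k : ℕ) by simp [idx], prod_Icc_one_eq_prod_range]
    refine Finset.prod_congr rfl fun t _ => ?_
    congr 1
    simp only [idx]
    push_cast
    ring
  have hIcc2 : ∀ k : Fin m, ∏ j ∈ Finset.Icc (1 : ℤ) (l k - idx k),
      (qInt (q ^ 2) (2 * ((X : ℤ) + idx k + j + (0 : ℕ) + 1)) *
        qInt (q ^ 2) (2 * ((X : ℤ) - idx k - j + m + 1))) =
      (∏ t ∈ Finset.range (l k - (k + 1)), qInt (q ^ 2) (2 * ((X : ℤ) + (k : ℕ) + t + 3))) *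
        ∏ t ∈ Finset.range (l k - (k + 1)),
          qInt (q ^ 2) (2 * ((X : ℤ) + m - (k : ℕ) - t - 1)) := by
    intro k
    have := (hl k).1
    rw [show (l k - idx k : ℤ) = (l k - (k + 1) : ℕ) by simp only [idx]; omega,
      prod_Icc_one_eq_prod_range, ← Finset.prod_mul_distrib]
    refine Finset.prod_congr rfl fun t _ => ?_
    congr 2 <;>
    · simp only [idx]
      push_cast
      ring
  have hmid : ∀ k : Fin m, qInt (q ^ 2) (2 * ((X : ℤ) + (0 : ℕ) + idx k)) *
      qInt (q ^ 2) (2 * ((X : ℤ) + (0 : ℕ) + idx k + 1)) =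
      qInt (q ^ 2) (2 * (X + (k : ℕ) + 1)) * qInt (q ^ 2) (2 * (X + (k : ℕ) + 2)) := by
    intro k
    congr 2
  have hempty : Finset.Icc (1 : ℤ) (((0 : ℕ) + 1) / 2) = ∅ := by
    rw [Finset.Icc_eq_empty]
    norm_num
  simp only [hfact, hIcc1, hIcc2, hmid, hempty, Finset.univ_eq_empty, Finset.prod_empty, mul_one,
    Finset.prod_const_one, one_mul]
  have hall := Finset.prod_congr rfl fun k (_ : k ∈ Finset.univ) =>
    prod_qInt_eq_symFactor hq hs (show d ≤ X + m by omega) hmono hl k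
  simp only [Finset.prod_mul_distrib, Finset.prod_div_distrib, ← zpow_sum hq] at hall
  have hqe : q ^ (∑ k, qExponent X m l k) ≠ 0 := zpow_ne_zero _ hq
  rw [← mul_right_inj' hqe, mul_left_comm (q ^ _) (2 ^ _) (∏ k, symFactor q X m l k), ← hall,
    zpow_neg q]
  simp only [Finset.prod_mul_distrib]
  field_simp

/-- Both sides run over a triangular array: row `u + 1` on the left is column `u` on the right, read
backwards. -/
theorem prod_range_sDiff_triangle (q : K) (X m : ℕ) :
    ∏ k : Fin m, ∏ t ∈ Finset.range k, sDiff q (2 * X + (k : ℕ) + 3 + t) =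
      ∏ k : Fin m, ∏ u ∈ Finset.range (m - 1),
        if u < (k : ℕ) then 1 else sDiff q (2 * (X + 2 + u) - (k : ℕ)) := by
  rw [Fin.prod_univ_eq_prod_range
      (fun k => ∏ t ∈ Finset.range k, sDiff q (2 * X + (k : ℕ) + 3 + t)),
    Fin.prod_univ_eq_prod_range (fun k => ∏ u ∈ Finset.range (m - 1),
      if u < k then 1 else sDiff q (2 * (X + 2 + u) - (k : ℕ)))]
  obtain _ | m := m
  · simp
  rw [Finset.prod_range_succ', Nat.add_sub_cancel, Finset.prod_comm]
  simp only [Finset.range_zero, Finset.prod_empty, mul_one]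
  refine Finset.prod_congr rfl fun u hu => ?_
  have hu' := Finset.mem_range.1 hu
  rw [← Finset.prod_range_reflect, show m + 1 = (u + 1) + (m - u) by omega,
    Finset.prod_range_add _ (u + 1), Finset.prod_eq_one (s := Finset.range (m - u)), mul_one]
  · refine Finset.prod_congr rfl fun t ht => ?_
    have ht' := Finset.mem_range.1 ht
    rw [if_neg (by omega)]
    congr 1
    push_cast
    omega
  · exact fun t _ => if_pos (by omega)

theorem tilingGF_regionB_eq_Q {q : K} (hq : q ≠ 0) (h2 : (2 : K) ≠ 0)
    (hs : ∀ n : ℕ, sDiff q (n + 1) ≠ 0) {x d m : ℕ} (hmd : m ≤ d)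
    {l : Fin m → ℕ} (hmono : StrictMono l) (hl : ∀ i, 1 ≤ l i ∧ l i ≤ d) :
    tilingGF q (regionB x d l) = Q q x 0 d l ![] := by
  obtain ⟨X, hX⟩ : ∃ X, X + m = x + d := ⟨x + d - m, by omega⟩
  -- This makes the truncated subtraction `l k - (k + 1)` exact.
  have hk : ∀ k : Fin m, (k : ℕ) + 1 ≤ l k := by
    rintro ⟨n, hn⟩
    induction n with
    | zero => exact (hl _).1
    | succ n ih =>
      have h3 := ih (by omega)
      have h4 : l ⟨n, by omega⟩ < l ⟨n + 1, hn⟩ := hmono (by simp)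
      simp only at h3 ⊢
      omega
  rw [tilingGF_regionB_eq_prod hq h2 hs hX hmono hl,
    Q_eq_prod_symFactor hq hs hX hmd hmono fun k => ⟨hk k, (hl k).2⟩]
  have hF : (2 : K) ^ (-FPrime l ![]) =
      (∏ k : Fin m, (2 : K) ^ (k : ℕ)) / ∏ k : Fin m, (2 : K) ^ (2 * l k) := by
    have h3 : -FPrime l ![] = ∑ k : Fin m, (((k : ℕ) : ℤ) - (2 * l k : ℕ)) := by
      have h4 : ((((0 : ℕ) : ℤ) + 1) * m : ℤ) = ∑ k : Fin m, (1 : ℤ) := by simp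
      rw [FPrime, h4, ← Finset.sum_add_distrib]
      simp only [Finset.univ_eq_empty, Finset.sum_empty, add_zero]
      rw [← Finset.sum_neg_distrib]
      refine Finset.sum_congr rfl fun k _ => ?_
      simp only [idx]
      push_cast
      ring
    rw [h3, zpow_sum h2, ← Finset.prod_div_distrib]
    refine Finset.prod_congr rfl fun k _ => ?_
    rw [zpow_sub₀ h2, zpow_natCast, zpow_natCast]
  -- The factors agree with those of the determinant only up to the last quotient, whose product
  -- over all `k` is `1` because `Fin.rev` permutes the indices.
  have hS : ∀ k, symFactor q X m l k =
      (∏ i ∈ Finset.univ.filter (· < k), sDiff q (2 * (l k : ℤ) - 2 * (l i : ℤ))) *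
      (∏ t ∈ Finset.range k, sDiff q (2 * X + (k : ℕ) + 3 + t)) *
      (sFactTwo q (X + 1 + l k) / (sFactTwo q (X + m - l k) * sFact q (2 * l k))) *
      (sFactTwo q (X + (Fin.rev k : ℕ)) / sFactTwo q (X + (k : ℕ))) := by
    intro k
    have hk1 := hk k
    have hk2 := hl k
    have hk3 := k.2
    have e1 := sFactTwo_add q (X + k) (2 + (l k - (k + 1)))
    rw [show X + k + (2 + (l k - (k + 1))) = X + 1 + l k by omega, Finset.prod_range_add,
      Finset.prod_range_succ, Finset.prod_range_one] at e1
    have e2 := sFactTwo_add q (X + m - l k) (l k - (k + 1))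
    rw [show X + m - l k + (l k - (k + 1)) = X + (Fin.rev k : ℕ) by rw [Fin.val_rev]; omega,
      ← Finset.prod_range_reflect] at e2
    have e3 : ∏ t ∈ Finset.range (2 * l k), sDiff q (1 + t) = sFact q (2 * l k) :=
      Finset.prod_congr rfl fun t _ => by rw [add_comm]
    have e4 : ∏ t ∈ Finset.range (l k - (k + 1)), sDiff q (2 * ((X : ℤ) + m - (k : ℕ) - t - 1)) =
        ∏ t ∈ Finset.range (l k - (k + 1)),
          sDiff q (2 * ((X + m - l k : ℕ) + (l k - (k + 1) - 1 - t : ℕ) + 1)) := by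
      refine Finset.prod_congr rfl fun t ht => ?_
      have := Finset.mem_range.1 ht
      congr 1
      omega
    have e5 : ∏ t ∈ Finset.range (l k - (k + 1)), sDiff q (2 * ((X : ℤ) + (k : ℕ) + t + 3)) =
        ∏ t ∈ Finset.range (l k - (k + 1)),
          sDiff q (2 * ((X + k : ℕ) + (2 + t : ℕ) + 1)) := by
      refine Finset.prod_congr rfl fun t _ => ?_
      congr 1
      push_cast
      ring
    have e6 : sDiff q (2 * ((X + k : ℕ) + (0 : ℕ) + 1)) = sDiff q (2 * (X + (k : ℕ) + 1)) := by
      congr 1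
    have e7 : sDiff q (2 * ((X + k : ℕ) + (1 : ℕ) + 1)) = sDiff q (2 * (X + (k : ℕ) + 2)) := by
      congr 1
    have n1 := sFactTwo_ne_zero hs (X + k)
    have n2 := sFactTwo_ne_zero hs (X + m - l k)
    have n3 := sFact_ne_zero hs (2 * l k)
    rw [symFactor, e1, e2, e3, e4, e5, e6, e7]
    simp only [mul_sub]
    field_simp
  have hrev : ∏ k : Fin m, sFactTwo q (X + (Fin.rev k : ℕ)) =
      ∏ k : Fin m, sFactTwo q (X + (k : ℕ)) :=
    Equiv.prod_comp Fin.revPerm fun k : Fin m => sFactTwo q (X + (k : ℕ))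
  have hn : ∏ k : Fin m, sFactTwo q (X + (k : ℕ)) ≠ 0 :=
    Finset.prod_ne_zero_iff.2 fun k _ => sFactTwo_ne_zero hs _
  rw [hF, ← prod_range_sDiff_triangle]
  simp only [hS, Finset.prod_mul_distrib, Finset.prod_div_distrib, hrev, div_self hn, mul_one]
  simp only [div_eq_mul_inv, mul_inv]
  ring

end ProductFormula

end HalvedHexagon

/-- Vanishing would mean `q^(2n+2) = 1`, which degrees exclude for an indeterminate. -/
theorem HalvedHexagon.sDiff_ratFunc_X_ne_zero (n : ℕ) :
    HalvedHexagon.sDiff (RatFunc.X : RatFunc ℚ) (n + 1) ≠ 0 := by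
  have hX : (RatFunc.X : RatFunc ℚ) ≠ 0 := RatFunc.X_ne_zero
  intro h
  rw [HalvedHexagon.sDiff, sub_eq_zero, zpow_neg, ← mul_eq_one_iff_eq_inv₀ (zpow_ne_zero _ hX),
    ← zpow_add₀ hX] at h
  have h1 : ((n : ℤ) + 1 + (n + 1)) = ((2 * n + 2 : ℕ) : ℤ) := by push_cast; ring
  rw [h1, zpow_natCast, ← RatFunc.algebraMap_X, ← map_pow, ← map_one (algebraMap (Polynomial ℚ) (RatFunc ℚ))] at h
  have h2 := congrArg Polynomial.natDegree (RatFunc.algebraMap_injective ℚ h)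
  simp at h2

theorem mainTheorem8 (x d m : ℕ) (hmd : m ≤ d) (l : Fin m → ℕ) (hmono : StrictMono l)
    (hl : ∀ i, 1 ≤ l i ∧ l i ≤ d) :
    HalvedHexagon.tilingGF (RatFunc.X : RatFunc ℚ) (HalvedHexagon.regionB x d l) =
      HalvedHexagon.Q (RatFunc.X : RatFunc ℚ) x 0 d l ![] :=
  HalvedHexagon.tilingGF_regionB_eq_Q RatFunc.X_ne_zero two_ne_zero
    HalvedHexagon.sDiff_ratFunc_X_ne_zero hmd hmono hl
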